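/- Digraphs here are finite and loopless, with at most one arc from $u$ to $v$ for each ordered pair $(u,v)$ (both $\overrightarrow{uv}$ and $\overrightarrow{vu}$ may be present). Let $d(u,v)\in\mathbb{N}\cup\{\infty\}$ be the least number of arcs of a directed walk from $u$ to $v$. The outradius of a digraph with vertex set $V$ is $\operatorname{rad}^+=\min_{x\in V}\max_{u\in V} d(x,u)$. The digraph is biconnected if $d(u,v)<\infty$ for all $u,v\in V$, and bipartite if $V$ splits into two classes such that every arc joins vertices of different classes. Write $A(D)$ for the set of arcs of $D$. For $r\ge 1$ let $D_{2r,r,1}$ be the digraph on $\{v_1,\dots,v_r\}\cup\{w_1,\dots,w_r\}$ with arcs $$\{\overrightarrow{v_iv_j}: i\ne j,\ i\ge j-1\}\cup\{\overrightarrow{w_iw_j}: i\ne j,\ i\ge j-1\}\cup\{\overrightarrow{v_iw_1}:1\le i\le r\}\cup\{\overrightarrow{w_iv_1}:1\le i\le r\}.$$ For $n\ge 2r$ and $1\le s\le\frac{n-2r+2}{2}$ let $D_{n,r,s}$ be obtained from it by blowing up $v_1$ into a bidirected clique on $s$ vertices and $w_1$ into a bidirected clique on $n-2r+2-s$ vertices: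 every copy of a vertex has the same arcs to and from (copies of) the other vertices as the original vertex. For even $r$ and $s=\lfloor\frac n2-(r-1)\rfloor$, the set of all copies of the vertices $v_i$ with $i$ odd and $w_i$ with $i$ even has $\lfloor\frac n2\rfloor$ elements, and its complement has $\lceil\frac n2\rceil$ elements. Let $$E_{n,r}=D_{n,r,\lfloor \frac n2-(r-1)\rfloor}\cap K_{\lfloor\frac n2\rfloor,\lceil\frac n2\rceil}$$ be the digraph obtained from $D_{n,r,s}$ by keeping exactly the arcs that join these two classes. **Theorem.** Let $r\ge 4$ be even. Then there is a value $n_1(r)$ such that for every $n\ge n_1(r)$ the digraph $E_{n,r}$ is bipartite and biconnected, of order $n$ and outradius $r$, and every bipartite biconnected digraph $D$ of order $n$ and outradius $r$ satisfies $$|A(D)|\le |A(E_{n,r})|,$$ with equality only if $D$ is isomorphic to $E_{n,r}$. That is, $E_{n,r}$ is, up to isomorphism, the unique bipartite biconnected digraph of maximum size given order $n$ and outradius $r$. -/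

import Mathlib

namespace DirectedGraph

/-- The size of a digraph: its number of arcs. -/
noncomputable def size {V : Type*} (D : Digraph V) : ℕ :=
  {a : V × V | D.Adj a.1 a.2}.ncard

/-- There is a directed walk with exactly `k` arcs from `u` to `v`. -/
def HasWalk {V : Type*} (D : Digraph V) : ℕ → V → V → Prop
  | 0, u, v => u = v
  | k + 1, u, v => ∃ w, D.Adj u w ∧ HasWalk D k w v

/-- The distance from `u` to `v`: the least number of arcs of a directed walk from `u` to `v`,
and `⊤` if there is none. -/
noncomputable def dist {V : Type*} (D : Digraph V) (u v : V) : ℕ∞ :=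
  ⨅ (k : ℕ) (_ : HasWalk D k u v), (k : ℕ∞)

/-- The out-eccentricity `max_u d(v, u)`. -/
noncomputable def outEcc {V : Type*} (D : Digraph V) (v : V) : ℕ∞ :=
  ⨆ u, dist D v u

/-- The outradius `min_v max_u d(v, u)`. -/
noncomputable def outRadius {V : Type*} (D : Digraph V) : ℕ∞ :=
  ⨅ v, outEcc D v

/-- All distances are finite. -/
def Biconnected {V : Type*} (D : Digraph V) : Prop :=
  ∀ u v, dist D u v ≠ ⊤

/-- The bidirected complete bipartite digraph with bipartition classes `S` and `Sᶜ`. -/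
def completeBipartite {V : Type*} (S : Set V) : Digraph V where
  Adj u v := (u ∈ S ∧ v ∉ S) ∨ (u ∉ S ∧ v ∈ S)

/-- The vertices split into two classes such that every arc joins different classes;
in particular there are no loops. -/
def Bipartite {V : Type*} (D : Digraph V) : Prop :=
  ∃ S : Set V, D ≤ completeBipartite S

/-- Isomorphism of digraphs. -/
def Isomorphic {V W : Type*} (D : Digraph V) (E : Digraph W) : Prop :=
  Nonempty (D.Adj ≃r E.Adj)

/-- The digraph `D_{2r,r,1}`. The vertices `v₁, …, v_r` are `Sum.inl 0, …, Sum.inl (r - 1)` and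
`w₁, …, w_r` are `Sum.inr 0, …, Sum.inr (r - 1)`. -/
def baseDigraph (r : ℕ) : Digraph (Fin r ⊕ Fin r) where
  Adj
    | .inl i, .inl j => i ≠ j ∧ j.val ≤ i.val + 1
    | .inr i, .inr j => i ≠ j ∧ j.val ≤ i.val + 1
    | .inl _, .inr j => j.val = 0
    | .inr _, .inl j => j.val = 0

/-- The blow-up of each vertex `x` of a (loopless) digraph by a bidirected clique on `m x`
vertices. -/
def cliqueBlowUp {B : Type*} (D : Digraph B) (m : B → ℕ) : Digraph (Σ x : B, Fin (m x)) where
  Adj p q := D.Adj p.1 q.1 ∨ (p.1 = q.1 ∧ p ≠ q)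

/-- The clique sizes in `D_{n,r,s}`: `s` at `v₁`, `n - 2r + 2 - s` at `w₁`, and `1` elsewhere. -/
def blowUpSize (n r s : ℕ) : Fin r ⊕ Fin r → ℕ
  | .inl i => if i.val = 0 then s else 1
  | .inr i => if i.val = 0 then n - 2 * r + 2 - s else 1

/-- The vertex set of `D_{n,r,s}`. -/
abbrev DVertex (n r s : ℕ) : Type :=
  Σ x : Fin r ⊕ Fin r, Fin (blowUpSize n r s x)

/-- The digraph `D_{n,r,s}`, meant for `2r ≤ n` and `1 ≤ s ≤ (n - 2r + 2) / 2`. -/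
def D (n r s : ℕ) : Digraph (DVertex n r s) :=
  cliqueBlowUp (baseDigraph r) (blowUpSize n r s)

/-- The class `{v_i | i odd} ∪ {w_i | i even}` of `D_{2r,r,1}` (with `v_i`, `w_i` numbered from
`1`, hence the shift by one). -/
def baseClass (r : ℕ) : Set (Fin r ⊕ Fin r) :=
  {x | match x with
    | .inl i => Odd (i.val + 1)
    | .inr i => Even (i.val + 1)}

/-- The copies in `D_{n,r,s}` of the vertices in `baseClass`. -/
def DClass (n r s : ℕ) : Set (DVertex n r s) :=
  {p | p.1 ∈ baseClass r}

/-- The parameter `s = ⌊n/2 - (r - 1)⌋`. -/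
def balancedParam (n r : ℕ) : ℕ := n / 2 - (r - 1)

/-- The digraph `D_{n,r,s} ∩ K_{⌊n/2⌋,⌈n/2⌉}` with `s = ⌊n/2 - (r - 1)⌋`. That the bipartition
classes have `⌊n/2⌋` and `⌈n/2⌉` vertices when `r` is even is `ncard_DClass` and
`ncard_compl_DClass` below. -/
def extremal (n r : ℕ) : Digraph (DVertex n r (balancedParam n r)) :=
  D n r (balancedParam n r) ⊓ completeBipartite (DClass n r (balancedParam n r))

theorem sum_blowUp_odd (s k : ℕ) (hk : 1 ≤ k) :
    ∑ i ∈ Finset.range (2 * k), (if Odd (i + 1) then (if i = 0 then s else 1) else 0)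
      = s + (k - 1) := by
  induction k, hk using Nat.le_induction with
  | base => simp [Finset.sum_range_succ]
  | succ k hk ih =>
    have h1 : Odd (2 * k + 1) := ⟨k, rfl⟩
    have h2 : ¬ Odd (2 * k + 1 + 1) := by rw [Nat.not_odd_iff_even]; exact ⟨k + 1, by ring⟩
    rw [show 2 * (k + 1) = 2 * k + 1 + 1 by ring, Finset.sum_range_succ, Finset.sum_range_succ, ih,
      if_pos h1, if_neg h2, if_neg (by omega)]
    omega

theorem sum_blowUp_even (s k : ℕ) :
    ∑ i ∈ Finset.range (2 * k), (if Even (i + 1) then (if i = 0 then s else 1) else 0) = k := by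
  induction k with
  | zero => simp
  | succ k ih =>
    have h1 : ¬ Even (2 * k + 1) := by rw [Nat.not_even_iff_odd]; exact ⟨k, rfl⟩
    have h2 : Even (2 * k + 1 + 1) := ⟨k + 1, by ring⟩
    rw [show 2 * (k + 1) = 2 * k + 1 + 1 by ring, Finset.sum_range_succ, Finset.sum_range_succ, ih,
      if_neg h1, if_pos h2, if_neg (by omega)]

open Classical in
theorem ncard_copies {B : Type*} [Fintype B] (m : B → ℕ) (S : Set B) :
    {p : Σ x : B, Fin (m x) | p.1 ∈ S}.ncard = ∑ x, if x ∈ S then m x else 0 := by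
  rw [Set.ncard_eq_toFinset_card']
  have : {p : Σ x : B, Fin (m x) | p.1 ∈ S}.toFinset
      = (Finset.univ.filter (· ∈ S)).sigma fun _ => Finset.univ := by
    ext p; simp
  rw [this, Finset.card_sigma, Finset.sum_filter]
  simp

theorem inl_mem_baseClass (r : ℕ) (i : Fin r) : .inl i ∈ baseClass r ↔ Odd (i.val + 1) := Iff.rfl

theorem inr_mem_baseClass (r : ℕ) (i : Fin r) : .inr i ∈ baseClass r ↔ Even (i.val + 1) := Iff.rfl

theorem ncard_DClass (n r : ℕ) (hr : 1 ≤ r) (hr_even : Even r) (hn : 2 * r ≤ n) :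
    (DClass n r (balancedParam n r)).ncard = n / 2 := by
  classical
  obtain ⟨k, rfl⟩ := hr_even
  rw [← two_mul] at *
  have e1 := sum_blowUp_odd (balancedParam n (2 * k)) k (by omega)
  have e2 := sum_blowUp_even (n - 2 * (2 * k) + 2 - balancedParam n (2 * k)) k
  rw [Finset.sum_range] at e1 e2
  refine (ncard_copies _ (baseClass (2 * k))).trans ?_
  simp only [Fintype.sum_sum_type, inl_mem_baseClass, inr_mem_baseClass, blowUpSize]
  rw [e1, e2]
  unfold balancedParam
  omega

theorem ncard_compl_DClass (n r : ℕ) (hr : 1 ≤ r) (hr_even : Even r) (hn : 2 * r ≤ n) :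
    ((DClass n r (balancedParam n r))ᶜ).ncard = (n + 1) / 2 := by
  classical
  obtain ⟨k, rfl⟩ := hr_even
  rw [← two_mul] at *
  have e1 := sum_blowUp_odd (n - 2 * (2 * k) + 2 - balancedParam n (2 * k)) k (by omega)
  have e2 := sum_blowUp_even (balancedParam n (2 * k)) k
  rw [Finset.sum_range] at e1 e2
  refine (ncard_copies _ (baseClass (2 * k))ᶜ).trans ?_
  simp only [Fintype.sum_sum_type, Set.mem_compl_iff, inl_mem_baseClass, inr_mem_baseClass,
    blowUpSize, Nat.not_odd_iff_even, Nat.not_even_iff_odd]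
  rw [e1, e2]
  unfold balancedParam
  omega

end DirectedGraph

/-!
Compared with a complete bipartite digraph, the extremal digraph misses about `(r - 2) n` arcs. To
prove it optimal, let `D` have at least as many arcs and large order `n`, with class `S`.

*Few far vertices.* Almost all vertices of `D` lie in a core of vertices that miss boundedly many
arcs. Averaging over the core yields a bidirected edge between `p ∈ S` and `q ∉ S` in the core that
misses at most `2r - 4` arcs from and to vertices outside the core (`exists_cheap_pair`). Adding
all arcs between `{p, q}` and the core does not shorten large distances: the distance to a vertex
outside the core still drops by at most one along every arc, since an added arc and the next arc of
a shortest walk join vertices at distance at most two in `D` (`CorePair.ndist_le_of_adj`).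

*The skeleton.* In the resulting digraph `H` at most `2r - 4` vertices are at distance at least two
from or to the pair `{p, q}`. Some vertex is at distance `r` or more from `p`, some from `q`. If
all vertices are within distance `r - 1` of the pair, this needs two disjoint walks with `r - 2`
vertices each at distance at least two from the pair, which uses up all `2r - 4` vertices. If some
vertex is at distance `M ≥ r` from the pair, then a vertex on the way to it needs a walk back to
the pair and another far vertex, which takes too many vertices (`Hub.exists_skeleton`).

*Exact comparison.* Once the two walks are known, the large out-eccentricities forbid almost all
arcs that the extremal structure does not have. The remaining ones are arcs from a vertex `x` other
than the second vertex of a walk to the third vertex of that walk; each excludes two arcs, between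
`x` and the second vertex of the other walk (`IsLabel.trade`). So `H` has at most as many arcs as a
blow-up of the base digraph at its two first vertices, and among those the balanced one is best
(`pullback_le_extremal`). As `D` is contained in `H` and has at least the size of the extremal
digraph, all these digraphs agree.
-/

namespace DirectedGraph

/-! ### Walks and natural-number distances -/

variable {V : Type*} {D : Digraph V} {u v w : V}

theorem HasWalk.append {j k : ℕ} (h₁ : HasWalk D j u v) (h₂ : HasWalk D k v w) :
    HasWalk D (j + k) u w := by
  induction j generalizing u with
  | zero => cases h₁; simpa using h₂
  | succ j ih =>
    obtain ⟨x, hx, hw⟩ := h₁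
    rw [Nat.succ_add]
    exact ⟨x, hx, ih hw⟩

theorem hasWalk_one (h : D.Adj u v) : HasWalk D 1 u v := ⟨v, h, rfl⟩

theorem HasWalk.mono {E : Digraph V} (hle : D ≤ E) {k : ℕ} (h : HasWalk D k u v) :
    HasWalk E k u v := by
  induction k generalizing u with
  | zero => exact h
  | succ k ih =>
    obtain ⟨x, hx, hw⟩ := h
    exact ⟨x, hle hx, ih hw⟩

theorem dist_le {k : ℕ} (h : HasWalk D k u v) : dist D u v ≤ k := iInf₂_le k h

theorem le_dist_iff {r : ℕ} : (r : ℕ∞) ≤ dist D u v ↔ ∀ k, HasWalk D k u v → r ≤ k := by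
  simp [dist, le_iInf_iff]

theorem dist_ne_top_iff : dist D u v ≠ ⊤ ↔ ∃ k, HasWalk D k u v := by
  refine ⟨fun h => ?_, fun ⟨k, hk⟩ => ne_top_of_le_ne_top (ENat.natCast_ne_top k) (dist_le hk)⟩
  by_contra! hn
  exact h (by simp [dist, hn])

/-- The distance as a natural number. Its value is meaningful only if there is a walk from `u` to
`v`, in particular in biconnected digraphs. -/
noncomputable def ndist (D : Digraph V) (u v : V) : ℕ := sInf {k | HasWalk D k u v}

theorem ndist_le {k : ℕ} (h : HasWalk D k u v) : ndist D u v ≤ k := Nat.sInf_le h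

theorem Biconnected.hasWalk_ndist (h : Biconnected D) (u v : V) :
    HasWalk D (ndist D u v) u v :=
  Nat.sInf_mem (dist_ne_top_iff.1 (h u v))

theorem Biconnected.mono {E : Digraph V} (h : Biconnected D) (hle : D ≤ E) : Biconnected E :=
  fun u v => dist_ne_top_iff.2 ⟨_, (h.hasWalk_ndist u v).mono hle⟩

theorem ndist_self (D : Digraph V) (u : V) : ndist D u u = 0 :=
  Nat.le_zero.1 (ndist_le (k := 0) rfl)

theorem ndist_le_one (h : D.Adj u v) : ndist D u v ≤ 1 := ndist_le (hasWalk_one h)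

theorem Biconnected.eq_of_ndist_eq_zero (h : Biconnected D) (h0 : ndist D u v = 0) : u = v := by
  have := h.hasWalk_ndist u v
  rw [h0] at this
  exact this

theorem Biconnected.ndist_triangle (h : Biconnected D) (u v w : V) :
    ndist D u w ≤ ndist D u v + ndist D v w :=
  ndist_le ((h.hasWalk_ndist u v).append (h.hasWalk_ndist v w))

theorem Biconnected.ndist_le_add_one (h : Biconnected D) (u : V) (hvw : D.Adj v w) :
    ndist D u w ≤ ndist D u v + 1 :=
  (h.ndist_triangle u v w).trans (Nat.add_le_add_left (ndist_le_one hvw) _)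

theorem Biconnected.ndist_le_one_add (h : Biconnected D) (huv : D.Adj u v) (w : V) :
    ndist D u w ≤ 1 + ndist D v w :=
  (h.ndist_triangle u v w).trans (Nat.add_le_add_right (ndist_le_one huv) _)

/-- A shortest walk has a first step, which decreases the distance to its end by one. -/
theorem Biconnected.exists_first_step (h : Biconnected D) (hne : u ≠ v) :
    ∃ x, D.Adj u x ∧ ndist D u v = ndist D x v + 1 := by
  have hw := h.hasWalk_ndist u v
  rcases hk : ndist D u v with _ | k
  · exact absurd (h.eq_of_ndist_eq_zero hk) hne
  · rw [hk] at hw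
    obtain ⟨x, hx, hxw⟩ := hw
    refine ⟨x, hx, ?_⟩
    have h1 := ndist_le hxw
    have h2 := h.ndist_le_one_add hx v
    omega

theorem HasWalk.exists_seq {k : ℕ} (h : HasWalk D k u v) :
    ∃ f : ℕ → V, f 0 = u ∧ f k = v ∧ ∀ i < k, D.Adj (f i) (f (i + 1)) := by
  induction k generalizing u with
  | zero => exact ⟨fun _ => u, rfl, h, by simp⟩
  | succ k ih =>
    obtain ⟨x, hx, hw⟩ := h
    obtain ⟨f, h0, hk, hf⟩ := ih hw
    refine ⟨fun i => i.casesOn u f, rfl, hk, fun i hi => ?_⟩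
    cases i with
    | zero => simpa [h0] using hx
    | succ i => exact hf i (by omega)

theorem hasWalk_of_seq {f : ℕ → V} {a b : ℕ} (hab : a ≤ b)
    (hf : ∀ i, a ≤ i → i < b → D.Adj (f i) (f (i + 1))) : HasWalk D (b - a) (f a) (f b) := by
  induction b, hab using Nat.le_induction with
  | base => simp [HasWalk]
  | succ b hab ih =>
    rw [Nat.succ_sub hab]
    exact (ih fun i h1 h2 => hf i h1 (by omega)).append (hasWalk_one (hf b hab (by omega)))

theorem ndist_le_of_seq {f : ℕ → V} {n a b : ℕ} (hf : ∀ i < n, D.Adj (f i) (f (i + 1)))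
    (hab : a ≤ b) (hb : b ≤ n) : ndist D (f a) (f b) ≤ b - a :=
  ndist_le (hasWalk_of_seq hab fun i _ h => hf i (h.trans_le hb))

theorem exists_le_ndist {r : ℕ} (h : Biconnected D) (hr : 1 ≤ r)
    (hrad : (r : ℕ∞) ≤ outRadius D) (x : V) : ∃ y, r ≤ ndist D x y := by
  by_contra! hlt
  have h1 : (r : ℕ∞) ≤ outEcc D x := hrad.trans (iInf_le _ x)
  have h2 : outEcc D x ≤ ((r - 1 : ℕ) : ℕ∞) := by
    refine iSup_le fun y => (dist_le (h.hasWalk_ndist x y)).trans ?_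
    have := hlt y
    exact_mod_cast (by omega : ndist D x y ≤ r - 1)
  have h3 : r ≤ r - 1 := by exact_mod_cast h1.trans h2
  omega

/-- In a bipartite digraph the classes alternate along a walk. -/
theorem mem_iff_of_seq {S : Set V} (hS : D ≤ completeBipartite S) {f : ℕ → V} {n : ℕ}
    (hf : ∀ i < n, D.Adj (f i) (f (i + 1))) {i : ℕ} (hi : i ≤ n) :
    f i ∈ S ↔ (Even i ↔ f 0 ∈ S) := by
  induction i with
  | zero => simp
  | succ i ih =>
    have h1 := ih (by omega)
    have h2 := hS (hf i (by omega))
    simp only [completeBipartite] at h2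
    rw [Nat.even_add_one]
    tauto

end DirectedGraph

namespace DirectedGraph

/-! ### Digraphs with few vertices far from a bidirected edge -/

/-- A biconnected bipartite digraph with class `S` and a bidirected edge between `p ∈ S` and
`q ∉ S`. -/
structure Hub {V : Type*} (H : Digraph V) (S : Set V) (p q : V) : Prop where
  bip : H ≤ completeBipartite S
  conn : Biconnected H
  mem : p ∈ S
  not_mem : q ∉ S
  pq : H.Adj p q
  qp : H.Adj q p

/-- The distance from the pair `{p, q}` to `u`. -/
noncomputable def lev {V : Type*} (H : Digraph V) (p q u : V) : ℕ :=
  min (ndist H p u) (ndist H q u)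

/-- The distance from `u` to the pair `{p, q}`. -/
noncomputable def ret {V : Type*} (H : Digraph V) (p q u : V) : ℕ :=
  min (ndist H u p) (ndist H u q)

variable {V : Type*} {H : Digraph V} {S : Set V} {p q : V}

theorem completeBipartite_compl (S : Set V) : completeBipartite Sᶜ = completeBipartite S := by
  ext u v
  simp [completeBipartite]
  tauto

theorem lev_comm (H : Digraph V) (p q u : V) : lev H p q u = lev H q p u := min_comm _ _

theorem ret_comm (H : Digraph V) (p q u : V) : ret H p q u = ret H q p u := min_comm _ _

theorem Hub.swap (h : Hub H S p q) : Hub H Sᶜ q p where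
  bip := by rw [completeBipartite_compl]; exact h.bip
  conn := h.conn
  mem := h.not_mem
  not_mem := fun hp => hp h.mem
  pq := h.qp
  qp := h.pq

theorem adj_mem_iff (hS : H ≤ completeBipartite S) {u v : V} (huv : H.Adj u v) :
    v ∈ S ↔ u ∉ S := by
  have := hS huv
  simp only [completeBipartite] at this
  tauto

namespace Hub

theorem lev_le_add_one (h : Hub H S p q) {u v : V} (huv : H.Adj u v) :
    lev H p q v ≤ lev H p q u + 1 := by
  have h1 := h.conn.ndist_le_add_one p huv
  have h2 := h.conn.ndist_le_add_one q huv
  simp only [lev]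
  omega

theorem ndist_p_le (h : Hub H S p q) (u : V) : ndist H p u ≤ lev H p q u + 1 := by
  have := h.conn.ndist_le_one_add h.pq u
  simp only [lev]
  omega

theorem ndist_q_le (h : Hub H S p q) (u : V) : ndist H q u ≤ lev H p q u + 1 := by
  have := h.conn.ndist_le_one_add h.qp u
  simp only [lev]
  omega

theorem ndist_le (h : Hub H S p q) (x y : V) :
    ndist H x y ≤ ret H p q x + 1 + lev H p q y := by
  have h1 := h.conn.ndist_triangle x p y
  have h2 := h.conn.ndist_triangle x q y
  have h3 := h.ndist_p_le y
  have h4 := h.ndist_q_le y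
  have h5 : ret H p q x = ndist H x p ∨ ret H p q x = ndist H x q := by
    simp only [ret]; omega
  omega

theorem lev_eq_zero (h : Hub H S p q) {u : V} : lev H p q u = 0 ↔ u = p ∨ u = q := by
  constructor
  · intro h0
    have : ndist H p u = 0 ∨ ndist H q u = 0 := by simp only [lev] at h0; omega
    rcases this with h1 | h1
    · exact .inl (h.conn.eq_of_ndist_eq_zero h1).symm
    · exact .inr (h.conn.eq_of_ndist_eq_zero h1).symm
  · rintro (rfl | rfl) <;> simp [lev, ndist_self]

theorem ret_eq_zero (h : Hub H S p q) {u : V} : ret H p q u = 0 ↔ u = p ∨ u = q := by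
  constructor
  · intro h0
    have : ndist H u p = 0 ∨ ndist H u q = 0 := by simp only [ret] at h0; omega
    rcases this with h1 | h1
    · exact .inl (h.conn.eq_of_ndist_eq_zero h1)
    · exact .inr (h.conn.eq_of_ndist_eq_zero h1)
  · rintro (rfl | rfl) <;> simp [ret, ndist_self]

theorem lev_of_seq (h : Hub H S p q) {f : ℕ → V} {n : ℕ} (h0 : lev H p q (f 0) = 0)
    (hn : lev H p q (f n) = n) (hf : ∀ i < n, H.Adj (f i) (f (i + 1))) {i : ℕ} (hi : i ≤ n) :
    lev H p q (f i) = i := by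
  have up : ∀ j ≤ n, lev H p q (f j) ≤ j := by
    intro j
    induction j with
    | zero => intro _; omega
    | succ j ih =>
      intro hj
      have := h.lev_le_add_one (hf j (by omega))
      have := ih (by omega)
      omega
  have down : ∀ j ≤ n, n ≤ lev H p q (f (n - j)) + j := by
    intro j
    induction j with
    | zero => intro _; simp [hn]
    | succ j ih =>
      intro hj
      have h1 := h.lev_le_add_one (hf (n - (j + 1)) (by omega))
      rw [show n - (j + 1) + 1 = n - j by omega] at h1
      have := ih (by omega)
      omega
  have h1 := up i hi
  have h2 := down (n - i) (by omega)
  rw [show n - (n - i) = i by omega] at h2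
  omega

theorem exists_geodesic (h : Hub H S p q) (y : V) :
    ∃ f : ℕ → V, f (lev H p q y) = y ∧ (∀ i < lev H p q y, H.Adj (f i) (f (i + 1))) ∧
      ∀ i ≤ lev H p q y, lev H p q (f i) = i := by
  have key : ∀ a, (a = p ∨ a = q) → ndist H a y = lev H p q y →
      ∃ f : ℕ → V, f (lev H p q y) = y ∧ (∀ i < lev H p q y, H.Adj (f i) (f (i + 1))) ∧
      ∀ i ≤ lev H p q y, lev H p q (f i) = i := by
    intro a ha hay
    obtain ⟨f, h0, h1, h2⟩ := (h.conn.hasWalk_ndist a y).exists_seq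
    rw [hay] at h1 h2
    exact ⟨f, h1, h2, fun i hi =>
      h.lev_of_seq (h.lev_eq_zero.2 (h0 ▸ ha)) (by rw [h1]) h2 hi⟩
  rcases le_total (ndist H p y) (ndist H q y) with hle | hle
  · exact key p (.inl rfl) (min_eq_left hle).symm
  · exact key q (.inr rfl) (min_eq_right hle).symm

theorem exists_return (h : Hub H S p q) (x : V) :
    ∃ t : ℕ → V, t 0 = x ∧ (∀ i < ret H p q x, H.Adj (t i) (t (i + 1))) ∧
      ∀ i ≤ ret H p q x, ret H p q (t i) = ret H p q x - i := by
  have key : ∀ a, (a = p ∨ a = q) → ndist H x a = ret H p q x →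
      ∃ t : ℕ → V, t 0 = x ∧ (∀ i < ret H p q x, H.Adj (t i) (t (i + 1))) ∧
      ∀ i ≤ ret H p q x, ret H p q (t i) = ret H p q x - i := by
    intro a ha hxa
    obtain ⟨f, h0, h1, h2⟩ := (h.conn.hasWalk_ndist x a).exists_seq
    rw [hxa] at h1 h2
    refine ⟨f, h0, h2, fun i hi => ?_⟩
    have e1 : ndist H x (f i) ≤ i := by
      have := ndist_le_of_seq h2 (Nat.zero_le i) hi
      rw [h0] at this
      omega
    have e2 : ndist H (f i) a ≤ ret H p q x - i := by
      have := ndist_le_of_seq h2 hi le_rfl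
      rwa [h1] at this
    have e3 := h.conn.ndist_triangle x (f i) p
    have e4 := h.conn.ndist_triangle x (f i) q
    rcases ha with rfl | rfl <;> simp only [ret] at * <;> omega
  rcases le_total (ndist H x p) (ndist H x q) with hle | hle
  · exact key p (.inl rfl) (min_eq_left hle).symm
  · exact key q (.inr rfl) (min_eq_right hle).symm

end Hub

/-- Let `f` be a shortest walk of length `M < r + i` from the pair `{p, q}`. A shortest walk from
the pair to a vertex at distance at least `r` from `f i` cannot meet `f` from `f i` on: it would
be short, since it is not longer than `f`. -/
theorem Hub.disjoint_geodesics [DecidableEq V] (h : Hub H S p q) {f z : ℕ → V} {i M m r a : ℕ}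
    (hf : ∀ i < M, H.Adj (f i) (f (i + 1))) (hlf : ∀ i ≤ M, lev H p q (f i) = i)
    (hz : ∀ i < m, H.Adj (z i) (z (i + 1))) (hlz : ∀ i ≤ m, lev H p q (z i) = i)
    (hmM : m ≤ M) (hM : M < r + i) (hia : i ≤ a)
    (hfar : r ≤ ndist H (f i) (z m)) :
    Disjoint ((Finset.Icc 2 M).image f) ((Finset.Icc a m).image z) := by
  rw [Finset.disjoint_left]
  intro u hu hu'
  obtain ⟨j, hj, rfl⟩ := Finset.mem_image.1 hu
  obtain ⟨k, hk, hjk⟩ := Finset.mem_image.1 hu'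
  rw [Finset.mem_Icc] at hj hk
  have e : k = j := by rw [← hlz k hk.2, hjk, hlf j hj.2]
  subst e
  have h1 := ndist_le_of_seq hf (show i ≤ k by omega) hj.2
  have h2 := ndist_le_of_seq hz hk.2 le_rfl
  rw [hjk] at h2
  have h3 := h.conn.ndist_triangle (f i) (f k) (z m)
  omega

/-- The vertices at distance at least two from the pair `{p, q}`. -/
noncomputable def outer [Fintype V] (H : Digraph V) (p q : V) : Finset V :=
  Finset.univ.filter fun u => 2 ≤ lev H p q u

/-- The vertices from which the pair `{p, q}` is at distance at least two. -/
noncomputable def slow [Fintype V] (H : Digraph V) (p q : V) : Finset V :=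
  Finset.univ.filter fun u => 2 ≤ ret H p q u

variable [Fintype V]

theorem mem_outer {u : V} : u ∈ outer H p q ↔ 2 ≤ lev H p q u := by simp [outer]

theorem mem_slow {u : V} : u ∈ slow H p q ↔ 2 ≤ ret H p q u := by simp [slow]

/-- Part of a shortest walk from the pair `{p, q}`, as a set of vertices at distance at least two
from the pair. -/
theorem Hub.card_image_outer [DecidableEq V] {f : ℕ → V} {a b : ℕ} (ha : 2 ≤ a)
    (hf : ∀ i ≤ b, lev H p q (f i) = i) :
    ((Finset.Icc a b).image f).card = b + 1 - a ∧ (Finset.Icc a b).image f ⊆ outer H p q := by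
  constructor
  · rw [Finset.card_image_of_injOn, Nat.card_Icc]
    intro i hi j hj hij
    simp only [Finset.coe_Icc, Set.mem_Icc] at hi hj
    rw [← hf i hi.2, ← hf j hj.2]
    exact congrArg _ hij
  · intro u hu
    obtain ⟨i, hi, rfl⟩ := Finset.mem_image.1 hu
    rw [Finset.mem_Icc] at hi
    rw [mem_outer, hf i hi.2]
    omega

theorem Hub.card_image_slow [DecidableEq V] {t : ℕ → V} {k : ℕ}
    (ht : ∀ i ≤ k, ret H p q (t i) = k - i) :
    ((Finset.range (k - 1)).image t).card = k - 1 ∧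
      (Finset.range (k - 1)).image t ⊆ slow H p q := by
  constructor
  · rw [Finset.card_image_of_injOn, Finset.card_range]
    intro i hi j hj hij
    simp only [Finset.coe_range, Set.mem_Iio] at hi hj
    have h1 := ht i (by omega)
    have h2 := ht j (by omega)
    rw [show t i = t j from hij, h2] at h1
    omega
  · intro u hu
    obtain ⟨i, hi, rfl⟩ := Finset.mem_image.1 hu
    rw [Finset.mem_range] at hi
    rw [mem_slow, ht i (by omega)]
    omega

/-- On a shortest walk `f` from the pair of maximal length `M > r`, the vertex `f (M - r + 1)` needs
its own walk back to the pair and, unless that walk is long, a vertex far from it. The walk `f`,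
the walk back and the walk from the pair to that vertex together use more than `2r - 4`
vertices. -/
theorem Hub.maxLev_le [DecidableEq V] (h : Hub H S p q) {r M : ℕ} (hr : 4 ≤ r)
    (hecc : ∀ x, (∃ y, r ≤ ndist H x y) ∨ r ≤ ret H p q x + 2)
    (hcard : (outer H p q).card + (slow H p q).card + 4 ≤ 2 * r)
    (hM : ∀ u, lev H p q u ≤ M) (hMex : ∃ u, lev H p q u = M) : M ≤ r := by
  by_contra! hlt
  obtain ⟨u, rfl⟩ := hMex
  obtain ⟨f, -, hf, hlf⟩ := h.exists_geodesic u
  set M := lev H p q u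
  set i := M - r + 1 with hi
  obtain ⟨t, -, ht, hrt⟩ := h.exists_return (f i)
  obtain ⟨c1, s1⟩ := Hub.card_image_outer le_rfl hlf
  obtain ⟨c2, s2⟩ := Hub.card_image_slow hrt
  have c2' := Finset.card_le_card s2
  rcases hecc (f i) with ⟨y, hy⟩ | hret
  · obtain ⟨z, hzy, hz, hlz⟩ := h.exists_geodesic y
    obtain ⟨c3, s3⟩ := Hub.card_image_outer (show 2 ≤ i by omega) hlz
    have hd := h.disjoint_geodesics hf hlf hz hlz (hM y) (show M < r + i by omega)
      le_rfl (hzy.symm ▸ hy)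
    have c4 := Finset.card_le_card (Finset.union_subset s1 s3)
    rw [Finset.card_union_of_disjoint hd] at c4
    have := h.ndist_le (f i) y
    omega
  · have c4 := Finset.card_le_card s1
    omega

/-- The case of maximal distance `r` from the pair. The count of `Hub.maxLev_le` is sharp here, so
all vertices of `outer` and `slow` are known; then no vertex can be far from the third vertex `f 2`
of the walk `f`. -/
theorem Hub.maxLev_ne [DecidableEq V] (h : Hub H S p q) {r : ℕ} (hr : 4 ≤ r)
    (hecc : ∀ x, (∃ y, r ≤ ndist H x y) ∨ r ≤ ret H p q x + 2)
    (hcard : (outer H p q).card + (slow H p q).card + 4 ≤ 2 * r)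
    (hM : ∀ u, lev H p q u ≤ r) (u : V) : lev H p q u ≠ r := by
  intro hu
  obtain ⟨f, -, hf, hlf⟩ := h.exists_geodesic u
  rw [hu] at hf hlf
  obtain ⟨t, ht0, ht, hrt⟩ := h.exists_return (f 1)
  obtain ⟨c1, s1⟩ := Hub.card_image_outer le_rfl hlf
  obtain ⟨c2, s2⟩ := Hub.card_image_slow hrt
  set ρ := ret H p q (f 1) with hρ
  have hρ1 : 1 ≤ ρ := by
    by_contra h0
    have := h.lev_eq_zero.2 (h.ret_eq_zero.1 (show ret H p q (f 1) = 0 by omega))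
    rw [hlf 1 (by omega)] at this
    omega
  -- `Z` is empty or the part of a shortest walk from the pair to a vertex far from `f 1`.
  obtain ⟨Z, hZ, hd, hZr, hZlev⟩ : ∃ Z : Finset V, Z ⊆ outer H p q ∧
      Disjoint ((Finset.Icc 2 r).image f) Z ∧ r ≤ ρ + 2 + Z.card ∧
      ∀ z ∈ Z, lev H p q z ≤ Z.card ∨
        (lev H p q z = Z.card + 1 ∧ r ≤ ndist H (f 1) z) := by
    rcases hecc (f 1) with ⟨y, hy⟩ | hret
    · obtain ⟨z, hzy, hz, hlz⟩ := h.exists_geodesic y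
      obtain ⟨c3, s3⟩ := Hub.card_image_outer le_rfl hlz
      refine ⟨_, s3, h.disjoint_geodesics hf hlf hz hlz (hM y) (show r < r + 1 by omega)
        (by omega) (hzy.symm ▸ hy), ?_, ?_⟩
      · have := h.ndist_le (f 1) y
        omega
      · intro v hv
        obtain ⟨j, hj, rfl⟩ := Finset.mem_image.1 hv
        rw [Finset.mem_Icc] at hj
        rw [c3, hlz j hj.2]
        rcases hj.2.lt_or_eq with hlt | rfl
        · left; omega
        · right; rw [hzy]; exact ⟨by omega, hy⟩
    · exact ⟨∅, by simp, by simp, by simpa using hret, by simp⟩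
  have c4 := Finset.card_le_card (Finset.union_subset s1 hZ)
  have c5 := Finset.card_le_card s2
  have c6 := Finset.card_union_of_disjoint hd
  have hO := Finset.eq_of_subset_of_card_le (Finset.union_subset s1 hZ) (by omega)
  have hI := Finset.eq_of_subset_of_card_le s2 (by omega)
  have hZr' : r = ρ + 2 + Z.card := by omega
  -- Now look at `f 2`: its return distance is small, so some vertex is far from it.
  have h20 : 1 ≤ ret H p q (f 2) := by
    by_contra h0
    have := h.lev_eq_zero.2 (h.ret_eq_zero.1 (show ret H p q (f 2) = 0 by omega))
    rw [hlf 2 (by omega)] at this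
    omega
  have hf12 : f 1 ≠ f 2 := fun e => by
    have := hlf 1 (by omega)
    rw [e, hlf 2 (by omega)] at this
    omega
  have h2 : ret H p q (f 2) ≤ ρ - 1 ∨ ret H p q (f 2) = 1 := by
    by_cases hs : f 2 ∈ slow H p q
    · rw [← hI] at hs
      obtain ⟨j, hj, hj2⟩ := Finset.mem_image.1 hs
      rw [Finset.mem_range] at hj
      have hj0 : j ≠ 0 := by
        rintro rfl
        exact hf12 (ht0.symm.trans hj2)
      rw [← hj2, hrt j (by omega)]
      left; omega
    · rw [mem_slow] at hs
      right; omega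
  obtain ⟨y, hy⟩ : ∃ y, r ≤ ndist H (f 2) y := by
    rcases hecc (f 2) with hy | hret
    · exact hy
    · omega
  have h2y := h.ndist_le (f 2) y
  have hyO : y ∈ outer H p q := by rw [mem_outer]; omega
  rw [← hO, Finset.mem_union] at hyO
  rcases hyO with hyX | hyZ
  · obtain ⟨j, hj, rfl⟩ := Finset.mem_image.1 hyX
    rw [Finset.mem_Icc] at hj
    have := ndist_le_of_seq hf hj.1 hj.2
    omega
  · have hρ' : ρ = 1 := by
      rcases hZlev y hyZ with h3 | ⟨h3, -⟩ <;> omega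
    obtain ⟨h3, h4⟩ : lev H p q y = Z.card + 1 ∧ r ≤ ndist H (f 1) y := by
      rcases hZlev y hyZ with h3 | h3
      · omega
      · exact h3
    -- `f 1` and `f 2` lie in different classes, so one is adjacent to `p`, the other to `q`.
    have key : ∀ a b x x', ndist H x a ≤ 1 → ndist H x' b ≤ 1 → r ≤ ndist H x y →
        r ≤ ndist H x' y → r ≤ ndist H a y + 1 ∧ r ≤ ndist H b y + 1 := by
      intro a b x x' e1 e2 e3 e4
      have := h.conn.ndist_triangle x a y
      have := h.conn.ndist_triangle x' b y
      omega
    have hadj : ∀ x, ret H p q x = 1 → (x ∈ S → ndist H x q ≤ 1) ∧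
        (x ∉ S → ndist H x p ≤ 1) := by
      intro x hx
      have step : ∀ a, ndist H x a = 1 → (a ∈ S ↔ x ∉ S) := by
        intro a hxa
        have := h.conn.hasWalk_ndist x a
        rw [hxa] at this
        obtain ⟨c, hc, rfl⟩ := this
        exact adj_mem_iff h.bip hc
      have hp := step p
      have hq := step q
      have := h.mem
      have := h.not_mem
      have : ndist H x p = 1 ∨ ndist H x q = 1 := by simp only [ret] at hx; omega
      constructor <;> intro hxS <;> rcases this with e | e <;> first | omega | tauto
    have hc := adj_mem_iff h.bip (hf 1 (by omega))
    have a1 := hadj _ (show ret H p q (f 1) = 1 by omega)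
    have a2 := hadj _ (show ret H p q (f 2) = 1 by omega)
    have hlev : r ≤ lev H p q y + 1 := by
      by_cases hS1 : f 1 ∈ S
      · have := key q p _ _ (a1.1 hS1) (a2.2 fun h2S => (hc.1 h2S) hS1) h4 hy
        simp only [lev]; omega
      · have := key p q _ _ (a1.2 hS1) (a2.1 (hc.2 hS1)) h4 hy
        simp only [lev]; omega
    omega

/-- Two walks starting at `p` and `q` such that the vertices at distance at least two from the
pair `{p, q}` are exactly the `v k` and `w k` with `k ≥ 2`, such that every vertex reaches the pair
in at most one step, and such that all out-eccentricities are at least `r`. -/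
structure Skeleton (H : Digraph V) (r : ℕ) (S : Set V) (p q : V) (v w : ℕ → V) : Prop
    extends Hub H S p q where
  v_zero : v 0 = p
  w_zero : w 0 = q
  adj_v : ∀ i, i + 1 < r → H.Adj (v i) (v (i + 1))
  adj_w : ∀ i, i + 1 < r → H.Adj (w i) (w (i + 1))
  pv : ∀ k < r, ndist H p (v k) = k
  qv : ∀ k < r, ndist H q (v k) = k + 1
  qw : ∀ k < r, ndist H q (w k) = k
  pw : ∀ k < r, ndist H p (w k) = k + 1
  outer_eq : ∀ u, 2 ≤ lev H p q u → ∃ k, 2 ≤ k ∧ k < r ∧ (u = v k ∨ u = w k)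
  ret_le : ∀ u, ret H p q u ≤ 1
  ecc : ∀ x, ∃ y, r ≤ ndist H x y

/-- If at most `2r - 4` vertices are at distance two or more from or to the pair `{p, q}`, then
these form two disjoint walks, one for a vertex far from `p` and one for a vertex far from `q`. The
second alternative of `hecc` is what remains of a large out-eccentricity after the completion of
the arcs between the pair and a core. -/
theorem Hub.exists_skeleton (h : Hub H S p q) {r : ℕ} (hr : 4 ≤ r)
    (hecc : ∀ x, (∃ y, r ≤ ndist H x y) ∨ r ≤ ret H p q x + 2)
    (hcard : (outer H p q).card + (slow H p q).card + 4 ≤ 2 * r) :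
    ∃ v w, Skeleton H r S p q v w := by
  classical
  obtain ⟨u, -, hu⟩ := Finset.exists_max_image Finset.univ (lev H p q) ⟨p, Finset.mem_univ p⟩
  have hM : ∀ v, lev H p q v ≤ r := fun v =>
    (hu v (Finset.mem_univ v)).trans
      (h.maxLev_le hr hecc hcard (fun v => hu v (Finset.mem_univ v)) ⟨u, rfl⟩)
  have hM' : ∀ v, lev H p q v < r := fun v =>
    (hM v).lt_of_ne (h.maxLev_ne hr hecc hcard hM v)
  have far : ∀ a, ret H p q a = 0 → ∃ y, r ≤ ndist H a y := by
    intro a ha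
    rcases hecc a with hy | hret
    · exact hy
    · omega
  have walk : ∀ a b, H.Adj b a → (∀ y, ndist H b y ≤ lev H p q y + 1) →
      (∀ y, lev H p q y ≤ ndist H a y ∧ lev H p q y ≤ ndist H b y ∧
        (lev H p q y = ndist H a y ∨ lev H p q y = ndist H b y)) → ret H p q b = 0 →
      ∃ f : ℕ → V, f 0 = a ∧ (∀ i, i + 1 < r → H.Adj (f i) (f (i + 1))) ∧
        (∀ k < r, ndist H a (f k) = k) ∧ (∀ k < r, ndist H b (f k) = k + 1) := by
    intro a b hba hle hlev hb
    obtain ⟨y, hy⟩ := far b hb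
    have h1 := hle y
    have h2 := hM' y
    have h3 := hlev y
    have hay : ndist H a y = r - 1 := by omega
    obtain ⟨f, h0, hl, hf⟩ := (h.conn.hasWalk_ndist a y).exists_seq
    rw [hay] at hl hf
    refine ⟨f, h0, fun i hi => hf i (by omega), fun k hk => ?_, fun k hk => ?_⟩
    all_goals
      have e1 := ndist_le_of_seq hf (Nat.zero_le k) (by omega)
      have e2 := ndist_le_of_seq hf (show k ≤ r - 1 by omega) le_rfl
      rw [h0] at e1
      rw [hl] at e2
      have e3 := h.conn.ndist_triangle a (f k) y
      have e4 := h.conn.ndist_triangle b (f k) y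
      have e5 := h.conn.ndist_le_one_add hba (f k)
      omega
  obtain ⟨v, v0, va, pv, qv⟩ := walk p q h.qp h.ndist_q_le (by intro y; simp only [lev]; omega)
    (h.ret_eq_zero.2 (.inr rfl))
  obtain ⟨w, w0, wa, qw, pw⟩ := walk q p h.pq h.ndist_p_le (by intro y; simp only [lev]; omega)
    (h.ret_eq_zero.2 (.inl rfl))
  have lv : ∀ k < r, lev H p q (v k) = k := by
    intro k hk; simp only [lev, pv k hk, qv k hk]; omega
  have lw : ∀ k < r, lev H p q (w k) = k := by
    intro k hk; simp only [lev, pw k hk, qw k hk]; omega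
  obtain ⟨c1, s1⟩ := Hub.card_image_outer (b := r - 1) le_rfl (fun i hi => lv i (by omega))
  obtain ⟨c2, s2⟩ := Hub.card_image_outer (b := r - 1) le_rfl (fun i hi => lw i (by omega))
  have hd : Disjoint ((Finset.Icc 2 (r - 1)).image v) ((Finset.Icc 2 (r - 1)).image w) := by
    rw [Finset.disjoint_left]
    intro u hu hu'
    obtain ⟨j, hj, rfl⟩ := Finset.mem_image.1 hu
    obtain ⟨k, hk, hjk⟩ := Finset.mem_image.1 hu'
    rw [Finset.mem_Icc] at hj hk
    have e1 := pv j (by omega)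
    have e2 := qv j (by omega)
    rw [← hjk] at e1 e2
    rw [pw k (by omega)] at e1
    rw [qw k (by omega)] at e2
    omega
  have c3 := Finset.card_le_card (Finset.union_subset s1 s2)
  have c4 := Finset.card_union_of_disjoint hd
  have hO := Finset.eq_of_subset_of_card_le (Finset.union_subset s1 s2) (by omega)
  have hI : slow H p q = ∅ := by rw [← Finset.card_eq_zero]; omega
  have hret : ∀ u, ret H p q u ≤ 1 := by
    intro u
    by_contra hu
    have : u ∈ slow H p q := mem_slow.2 (by omega)
    simp [hI] at this
  refine ⟨v, w, h, v0, w0, va, wa, pv, qv, qw, pw, fun u hu => ?_, hret, fun x => ?_⟩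
  · rw [← mem_outer, ← hO, Finset.mem_union, Finset.mem_image, Finset.mem_image] at hu
    rcases hu with ⟨k, hk, rfl⟩ | ⟨k, hk, rfl⟩ <;> rw [Finset.mem_Icc] at hk
    · exact ⟨k, by omega, by omega, .inl rfl⟩
    · exact ⟨k, by omega, by omega, .inr rfl⟩
  · rcases hecc x with hy | hx
    · exact hy
    · have := hret x
      omega

end DirectedGraph

namespace DirectedGraph

/-! ### Pullbacks of the base digraph -/

/-- The digraph on `V` whose arcs are the pairs that `φ` maps to arcs of `E`: up to isomorphism,
the blow-up of `E` by independent sets of the sizes of the fibres of `φ`. -/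
def pullback {V B : Type*} (φ : V → B) (E : Digraph B) : Digraph V where
  Adj u v := E.Adj (φ u) (φ v)

/-- The part of `D_{2r,r,1}` between the two classes. -/
def bipBase (r : ℕ) : Digraph (Fin r ⊕ Fin r) :=
  baseDigraph r ⊓ completeBipartite (baseClass r)

section bipBase

variable {r : ℕ} (i j : Fin r)

theorem bipBase_inl_inl : (bipBase r).Adj (.inl i) (.inl j) ↔
    j.val ≤ i.val + 1 ∧ (Even j.val ↔ ¬ Even i.val) := by
  have : i = j → i.val = j.val := congrArg _
  simp only [bipBase, Digraph.inf_adj, baseDigraph, completeBipartite, inl_mem_baseClass,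
    Nat.odd_add_one, Nat.not_odd_iff_even]
  grind

theorem bipBase_inr_inr : (bipBase r).Adj (.inr i) (.inr j) ↔
    j.val ≤ i.val + 1 ∧ (Even j.val ↔ ¬ Even i.val) := by
  have : i = j → i.val = j.val := congrArg _
  simp only [bipBase, Digraph.inf_adj, baseDigraph, completeBipartite, inr_mem_baseClass,
    Nat.even_add_one]
  grind

theorem bipBase_inl_inr : (bipBase r).Adj (.inl i) (.inr j) ↔ j.val = 0 ∧ Even i.val := by
  simp only [bipBase, Digraph.inf_adj, baseDigraph, completeBipartite, inr_mem_baseClass,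
    inl_mem_baseClass, Nat.even_add_one, Nat.odd_add_one, Nat.not_odd_iff_even]
  grind

theorem bipBase_inr_inl : (bipBase r).Adj (.inr i) (.inl j) ↔ j.val = 0 ∧ Even i.val := by
  simp only [bipBase, Digraph.inf_adj, baseDigraph, completeBipartite, inr_mem_baseClass,
    inl_mem_baseClass, Nat.even_add_one, Nat.odd_add_one, Nat.not_odd_iff_even]
  grind

theorem bipBase_swap (x y : Fin r ⊕ Fin r) :
    (bipBase r).Adj x.swap y.swap ↔ (bipBase r).Adj x y := by
  rcases x with i | i <;> rcases y with j | j <;>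
    simp [bipBase_inl_inl, bipBase_inl_inr, bipBase_inr_inl, bipBase_inr_inr]

theorem bipBase_le : bipBase r ≤ completeBipartite (baseClass r) := inf_le_right

end bipBase

theorem isomorphic_pullback {V W B : Type*} {E : Digraph B} {φ : V → B} {ψ : W → B}
    (h : ∀ x, Nonempty ({u // φ u = x} ≃ {u // ψ u = x})) :
    Isomorphic (pullback φ E) (pullback ψ E) := by
  let e : V ≃ W := (Equiv.sigmaFiberEquiv φ).symm.trans
    ((Equiv.sigmaCongrRight fun x => (h x).some).trans (Equiv.sigmaFiberEquiv ψ))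
  have he : ∀ u, ψ (e u) = φ u := fun u => ((h (φ u)).some ⟨u, rfl⟩).2
  refine ⟨e, fun {u v} => ?_⟩
  simp only [pullback, he]

theorem pullback_swap {V : Type*} {r : ℕ} (φ : V → Fin r ⊕ Fin r) :
    pullback (fun u => (φ u).swap) (bipBase r) = pullback φ (bipBase r) := by
  ext u v
  exact bipBase_swap _ _

theorem restrict_eq_pullback (n r s : ℕ) :
    D n r s ⊓ completeBipartite (DClass n r s) = pullback Sigma.fst (bipBase r) := by
  ext u v
  simp only [D, Digraph.inf_adj, cliqueBlowUp, pullback, bipBase, completeBipartite, DClass,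
    Set.mem_ofPred_eq]
  grind

open Classical in
theorem size_eq_sum {V : Type*} [Fintype V] (E : Digraph V) :
    size E = ∑ u, ∑ v, if E.Adj u v then 1 else 0 := by
  rw [size, Set.ncard_eq_toFinset_card', ← Finset.sum_product', Finset.card_eq_sum_ones,
    ← Finset.sum_filter]
  refine Finset.sum_congr ?_ fun _ _ => rfl
  ext a
  rw [Set.mem_toFinset, Finset.mem_filter]
  exact ⟨fun h => ⟨by simp, h⟩, fun h => h.2⟩

open Classical in
theorem size_pullback {V B : Type*} [Fintype V] [Fintype B] (φ : V → B) (E : Digraph B) :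
    size (pullback φ E) = ∑ x, ∑ y, (if E.Adj x y then 1 else 0) *
      ((Finset.univ.filter (φ · = x)).card * (Finset.univ.filter (φ · = y)).card) := by
  have h1 : size (pullback φ E) = ∑ u, ∑ v, if E.Adj (φ u) (φ v) then 1 else 0 :=
    size_eq_sum _
  rw [h1, ← Finset.sum_fiberwise' Finset.univ φ fun x => ∑ v, if E.Adj x (φ v) then 1 else 0]
  refine Finset.sum_congr rfl fun x _ => ?_
  rw [Finset.sum_const, smul_eq_mul,
    ← Finset.sum_fiberwise' Finset.univ φ fun y => if E.Adj x y then 1 else 0, Finset.mul_sum]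
  refine Finset.sum_congr rfl fun y _ => ?_
  rw [Finset.sum_const, smul_eq_mul]
  ring

/-- The number of arcs of a blow-up of `bipBase r` in which only the first vertices of the two
paths are blown up, to `a + 1` and `b + 1` copies. -/
theorem size_pullback_bipBase {V : Type*} [Fintype V] [DecidableEq V] {r a b : ℕ} (hr : 2 ≤ r)
    (φ : V → Fin r ⊕ Fin r)
    (hφ : ∀ x, (Finset.univ.filter (φ · = x)).card =
      1 + (if x = .inl ⟨0, by omega⟩ then a else 0) + (if x = .inr ⟨0, by omega⟩ then b else 0)) :
    size (pullback φ (bipBase r)) = size (bipBase r) + (r + 2) * (a + b) + 2 * (a * b) := by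
  classical
  have h0 := size_eq_sum (bipBase r)
  set x₀ : Fin r ⊕ Fin r := .inl ⟨0, by omega⟩ with hx₀
  set y₀ : Fin r ⊕ Fin r := .inr ⟨0, by omega⟩ with hy₀
  have e00 : ¬ (bipBase r).Adj x₀ x₀ := by rw [hx₀, bipBase_inl_inl]; tauto
  have e01 : (bipBase r).Adj x₀ y₀ := by rw [hx₀, hy₀, bipBase_inl_inr]; simp
  have e10 : (bipBase r).Adj y₀ x₀ := by rw [hx₀, hy₀, bipBase_inr_inl]; simp
  have e11 : ¬ (bipBase r).Adj y₀ y₀ := by rw [hy₀, bipBase_inr_inr]; tauto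
  -- The numbers of arcs to and from a first vertex.
  have sum1 : (∑ i : Fin r, if Even i.val then 1 else 0) +
      (∑ i : Fin r, if ¬ Even i.val then 1 else 0) = r := by
    rw [← Finset.sum_add_distrib]
    trans ∑ i : Fin r, 1
    · refine Finset.sum_congr rfl fun i _ => ?_
      split_ifs <;> rfl
    · simp
  have s0 : (∑ j : Fin r, if j.val = 0 then 1 else 0) = 1 := by
    rw [Finset.sum_eq_single ⟨0, by omega⟩] <;> simp [Fin.ext_iff]
  have s1 : (∑ j : Fin r, if j.val ≤ 1 ∧ ¬ Even j.val then 1 else 0) = 1 := by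
    rw [Finset.sum_eq_single ⟨1, by omega⟩]
    · simp
    · intro j _ hj
      rw [if_neg]
      rintro ⟨h1, h2⟩
      have h3 : j.val ≠ 0 := by intro h; simp [h] at h2
      exact hj (Fin.ext (by simp; omega))
    · simp
  have degx : (∑ y, if (bipBase r).Adj x₀ y then 1 else 0) +
      (∑ x, if (bipBase r).Adj x x₀ then 1 else 0) = r + 2 := by
    simp only [Fintype.sum_sum_type, hx₀, bipBase_inl_inl, bipBase_inl_inr, bipBase_inr_inl]
    simp only [Nat.zero_add, Even.zero, not_true, iff_false, Nat.zero_le, true_and, and_true,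
      true_iff]
    omega
  have degy : (∑ y, if (bipBase r).Adj y₀ y then 1 else 0) +
      (∑ x, if (bipBase r).Adj x y₀ then 1 else 0) = r + 2 := by
    simp only [Fintype.sum_sum_type, hy₀, bipBase_inr_inr, bipBase_inl_inr, bipBase_inr_inl]
    simp only [Nat.zero_add, Even.zero, not_true, iff_false, Nat.zero_le, true_and, and_true,
      true_iff]
    omega
  have expand : ∀ x y, (if (bipBase r).Adj x y then 1 else 0) *
      ((1 + (if x = x₀ then a else 0) + (if x = y₀ then b else 0)) *
        (1 + (if y = x₀ then a else 0) + (if y = y₀ then b else 0))) =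
      (if (bipBase r).Adj x y then 1 else 0)
      + (if x = x₀ then a * (if (bipBase r).Adj x₀ y then 1 else 0) else 0)
      + (if x = y₀ then b * (if (bipBase r).Adj y₀ y then 1 else 0) else 0)
      + (if y = x₀ then a * (if (bipBase r).Adj x x₀ then 1 else 0) else 0)
      + (if y = y₀ then b * (if (bipBase r).Adj x y₀ then 1 else 0) else 0)
      + (if x = x₀ then if y = y₀ then a * b else 0 else 0)
      + (if x = y₀ then if y = x₀ then a * b else 0 else 0) := by
    intro x y
    have hne : x₀ ≠ y₀ := by simp [hx₀, hy₀]
    by_cases h1 : x = x₀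
    · subst h1
      by_cases h3 : y = x₀
      · subst h3; simp [e00, hne]
      · by_cases h4 : y = y₀
        · subst h4; simp [e01, hne, hne.symm]; ring
        · simp [h3, h4, hne]; split_ifs <;> ring
    · by_cases h2 : x = y₀
      · subst h2
        by_cases h3 : y = x₀
        · subst h3; simp [e10, hne, hne.symm]; ring
        · by_cases h4 : y = y₀
          · subst h4; simp [e11, hne.symm]
          · simp [h3, h4, hne.symm]; split_ifs <;> ring
      · by_cases h3 : y = x₀
        · subst h3; simp [h1, h2, hne]; split_ifs <;> ring
        · by_cases h4 : y = y₀
          · subst h4; simp [h1, h2, hne.symm]; split_ifs <;> ring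
          · simp [h1, h2, h3, h4]
  have hconv : size (pullback φ (bipBase r)) = ∑ x, ∑ y, (if (bipBase r).Adj x y then 1 else 0) *
      ((1 + (if x = x₀ then a else 0) + (if x = y₀ then b else 0)) *
        (1 + (if y = x₀ then a else 0) + (if y = y₀ then b else 0))) := by
    rw [size_pullback]
    refine Finset.sum_congr rfl fun x _ => Finset.sum_congr rfl fun y _ => ?_
    rw [← hφ x, ← hφ y]
    congr!
  rw [hconv]
  simp only [expand, Finset.sum_add_distrib]
  have t1 : ∀ (z : Fin r ⊕ Fin r) (g : Fin r ⊕ Fin r → ℕ),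
      (∑ x, ∑ y, if x = z then g y else 0) = ∑ y, g y := by
    intro z g
    rw [Finset.sum_eq_single z] <;> simp +contextual
  have t2 : ∀ (z : Fin r ⊕ Fin r) (g : Fin r ⊕ Fin r → ℕ),
      (∑ x, ∑ y, if y = z then g x else 0) = ∑ x, g x := by
    intro z g
    exact Finset.sum_congr rfl fun x _ => by simp
  rw [t1 x₀, t1 y₀, t2 x₀, t2 y₀, t1 x₀ (fun y => if y = y₀ then a * b else 0),
    t1 y₀ (fun y => if y = x₀ then a * b else 0), ← h0]
  simp only [← Finset.mul_sum, Finset.sum_ite_eq', Finset.mem_univ, if_true]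
  linear_combination a * degx + b * degy

end DirectedGraph

namespace DirectedGraph

/-! ### Distances in pullbacks of the base digraph -/

section metric

variable {V : Type*} {r : ℕ} {φ : V → Fin r ⊕ Fin r}

theorem hasWalk_inl (hφ : Function.Surjective φ) {x : V} (hr : 0 < r)
    (hx : φ x = .inl ⟨0, hr⟩) (j : ℕ) (hj : j + 1 < r) (y : V)
    (hy : φ y = .inl ⟨j + 1, hj⟩) : HasWalk (pullback φ (bipBase r)) (j + 1) x y := by
  induction j generalizing y with
  | zero =>
    refine hasWalk_one ?_
    simp [pullback, hx, hy, bipBase_inl_inl]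
  | succ j ih =>
    obtain ⟨z, hz⟩ := hφ (.inl ⟨j + 1, by omega⟩)
    refine (ih (by omega) z hz).append (hasWalk_one ?_)
    simp [pullback, hz, hy, bipBase_inl_inl, Nat.even_add_one]

theorem hasWalk_inr (hφ : Function.Surjective φ) {x : V} (hr : 0 < r)
    (hx : φ x = .inl ⟨0, hr⟩) (j : ℕ) (hj : j < r) (y : V)
    (hy : φ y = .inr ⟨j, hj⟩) : HasWalk (pullback φ (bipBase r)) (j + 1) x y := by
  induction j generalizing y with
  | zero =>
    refine hasWalk_one ?_
    simp [pullback, hx, hy, bipBase_inl_inr]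
  | succ j ih =>
    obtain ⟨z, hz⟩ := hφ (.inr ⟨j, by omega⟩)
    refine (ih (by omega) z hz).append (hasWalk_one ?_)
    simp [pullback, hz, hy, bipBase_inr_inr, Nat.even_add_one]

theorem exists_hasWalk_le (hφ : Function.Surjective φ) {x : V} (hr : 2 ≤ r)
    (hx : φ x = .inl ⟨0, by omega⟩) (y : V) :
    ∃ k ≤ r, HasWalk (pullback φ (bipBase r)) k x y := by
  rcases hy : φ y with ⟨j, hj⟩ | ⟨j, hj⟩
  · rcases j with _ | j
    · obtain ⟨z, hz⟩ := hφ (.inr ⟨0, by omega⟩)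
      refine ⟨2, hr, z, ?_, y, ?_, rfl⟩
      · simp [pullback, hx, hz, bipBase_inl_inr]
      · simp [pullback, hy, hz, bipBase_inr_inl]
    · exact ⟨j + 1, hj.le, hasWalk_inl hφ _ hx j hj y hy⟩
  · exact ⟨j + 1, hj, hasWalk_inr hφ _ hx j hj y hy⟩

theorem exists_hasWalk_to (hφ : Function.Surjective φ) {x : V} (hr : 2 ≤ r)
    (hx : φ x = .inl ⟨0, by omega⟩) (y : V) :
    ∃ k, HasWalk (pullback φ (bipBase r)) k y x := by
  obtain ⟨z, hz⟩ := hφ (.inr ⟨0, by omega⟩)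
  have hzx : (pullback φ (bipBase r)).Adj z x := by simp [pullback, hx, hz, bipBase_inr_inl]
  rcases hy : φ y with i | i <;> by_cases hi : Even i.val
  · refine ⟨2, z, ?_, x, hzx, rfl⟩
    simp [pullback, hy, hz, bipBase_inl_inr, hi]
  · refine ⟨1, hasWalk_one ?_⟩
    simp only [pullback, hy, hx, bipBase_inl_inl, hi]
    simp
  · refine ⟨1, hasWalk_one ?_⟩
    simp only [pullback, hy, hx, bipBase_inr_inl, hi]
    simp
  · refine ⟨2, z, ?_, x, hzx, rfl⟩
    simp only [pullback, hy, hz, bipBase_inr_inr, hi]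
    simp

theorem biconnected_pullback (hφ : Function.Surjective φ) (hr : 2 ≤ r) :
    Biconnected (pullback φ (bipBase r)) := by
  intro u v
  obtain ⟨x, hx⟩ := hφ (.inl ⟨0, by omega⟩)
  obtain ⟨j, hj⟩ := exists_hasWalk_to hφ hr hx u
  obtain ⟨k, -, hk⟩ := exists_hasWalk_le hφ hr hx v
  exact dist_ne_top_iff.2 ⟨_, hj.append hk⟩

theorem le_outEcc_of_inl (hφ : Function.Surjective φ) (hr : 2 ≤ r) {x : V} {i : Fin r}
    (hx : φ x = .inl i) : (r : ℕ∞) ≤ outEcc (pullback φ (bipBase r)) x := by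
  obtain ⟨y, hy⟩ := hφ (.inr ⟨r - 1, by omega⟩)
  refine le_trans ?_ (le_iSup _ y)
  rw [le_dist_iff]
  -- A potential that drops by at most one along every arc.
  let f : Fin r ⊕ Fin r → ℕ := Sum.elim (fun _ => r) fun j => r - 1 - j.val
  have hf : ∀ a b, (bipBase r).Adj a b → f a ≤ f b + 1 := by
    rintro (a | a) (b | b) hab
    · simp [f]
    · rw [bipBase_inl_inr] at hab
      simp only [f, Sum.elim_inl, Sum.elim_inr]
      omega
    · simp only [f, Sum.elim_inl, Sum.elim_inr]
      omega
    · rw [bipBase_inr_inr] at hab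
      simp only [f, Sum.elim_inr]
      omega
  have hw : ∀ k u, HasWalk (pullback φ (bipBase r)) k u y → f (φ u) ≤ k := by
    intro k
    induction k with
    | zero =>
      rintro u rfl
      simp [hy, f]
    | succ k ih =>
      rintro u ⟨w, huw, hw⟩
      have h1 := ih w hw
      have h2 := hf _ _ huw
      omega
  intro k hk
  simpa [hx, f] using hw k x hk

theorem outRadius_pullback (hφ : Function.Surjective φ) (hr : 2 ≤ r) :
    outRadius (pullback φ (bipBase r)) = r := by
  apply le_antisymm
  · obtain ⟨x, hx⟩ := hφ (.inl ⟨0, by omega⟩)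
    refine (iInf_le _ x).trans (iSup_le fun y => ?_)
    obtain ⟨k, hk, hw⟩ := exists_hasWalk_le hφ hr hx y
    exact (dist_le hw).trans (by exact_mod_cast hk)
  · refine le_iInf fun x => ?_
    rcases hx : φ x with i | i
    · exact le_outEcc_of_inl hφ hr hx
    · rw [← pullback_swap]
      refine le_outEcc_of_inl (i := i) (fun z => ?_) hr (by simp [hx])
      obtain ⟨u, hu⟩ := hφ z.swap
      exact ⟨u, by simp [hu]⟩

theorem bipartite_pullback : Bipartite (pullback φ (bipBase r)) :=
  ⟨{u | φ u ∈ baseClass r}, fun {_ _} h => bipBase_le h⟩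

end metric

/-! ### The extremal digraph -/

theorem extremal_eq_pullback (n r : ℕ) :
    extremal n r = pullback (Sigma.fst : DVertex n r (balancedParam n r) → _) (bipBase r) :=
  restrict_eq_pullback n r _

theorem card_fiber_sigma {B : Type*} [Fintype B] [DecidableEq B] (m : B → ℕ) (x : B) :
    (Finset.univ.filter fun p : Σ x : B, Fin (m x) => p.1 = x).card = m x := by
  classical
  have := ncard_copies m {x}
  simp only [Set.mem_singleton_iff, Finset.sum_ite_eq', Finset.mem_univ, if_true] at this
  rw [← this, Set.ncard_eq_toFinset_card']
  congr 1
  ext p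
  rw [Set.mem_toFinset, Finset.mem_filter]
  exact ⟨fun h => h.2, fun h => ⟨by simp, h⟩⟩

theorem card_fiber_extremal {n r : ℕ} (hr : 1 ≤ r) (hn : 2 * r ≤ n) (x : Fin r ⊕ Fin r) :
    (Finset.univ.filter fun p : DVertex n r (balancedParam n r) => p.1 = x).card =
      1 + (if x = .inl ⟨0, by omega⟩ then n / 2 - r else 0) +
        (if x = .inr ⟨0, by omega⟩ then (n + 1) / 2 - r else 0) := by
  rw [card_fiber_sigma]
  rcases x with i | i <;> simp only [blowUpSize, balancedParam, Sum.inl.injEq, Sum.inr.injEq,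
    reduceCtorEq, if_false, Fin.ext_iff] <;> split_ifs <;> omega

theorem surjective_of_card_fiber {V : Type*} [Fintype V] {r a b : ℕ} (hr : 1 ≤ r)
    {φ : V → Fin r ⊕ Fin r}
    (hφ : ∀ x, (Finset.univ.filter (φ · = x)).card =
      1 + (if x = .inl ⟨0, by omega⟩ then a else 0) + (if x = .inr ⟨0, by omega⟩ then b else 0)) :
    Function.Surjective φ := by
  intro x
  have h : 0 < (Finset.univ.filter (φ · = x)).card := by rw [hφ x]; omega
  obtain ⟨u, hu⟩ := Finset.card_pos.1 h
  exact ⟨u, (Finset.mem_filter.1 hu).2⟩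

theorem surjective_extremal {n r : ℕ} (hr : 1 ≤ r) (hn : 2 * r ≤ n) :
    Function.Surjective (Sigma.fst : DVertex n r (balancedParam n r) → Fin r ⊕ Fin r) :=
  surjective_of_card_fiber hr (card_fiber_extremal hr hn)

theorem card_DVertex {n r : ℕ} (hr : 1 ≤ r) (hr_even : Even r) (hn : 2 * r ≤ n) :
    Fintype.card (DVertex n r (balancedParam n r)) = n := by
  have h1 := ncard_DClass n r hr hr_even hn
  have h2 := ncard_compl_DClass n r hr hr_even hn
  have h3 := Set.ncard_add_ncard_compl (DClass n r (balancedParam n r))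
  rw [Nat.card_eq_fintype_card] at h3
  omega

theorem size_extremal {n r : ℕ} (hr : 2 ≤ r) (hn : 2 * r ≤ n) :
    size (extremal n r) = size (bipBase r) + (r + 2) * ((n / 2 - r) + ((n + 1) / 2 - r)) +
      2 * ((n / 2 - r) * ((n + 1) / 2 - r)) := by
  rw [extremal_eq_pullback]
  exact size_pullback_bipBase hr _ (card_fiber_extremal (by omega) hn)

/-- The missing arcs of the extremal digraph, compared to a balanced complete bipartite digraph,
are at most `(r - 2) n` up to a constant. -/
theorem sq_le_size_extremal {n r : ℕ} (hr : 2 ≤ r) (hn : 2 * r ≤ n) :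
    n ^ 2 + 4 * n ≤ 2 * size (extremal n r) + 2 * r * n + 8 * r + 1 := by
  rw [size_extremal hr hn]
  obtain ⟨m, rfl⟩ : ∃ m, n = m + 2 * r := ⟨n - 2 * r, by omega⟩
  have e1 : (m + 2 * r) / 2 - r = m / 2 := by omega
  have e2 : (m + 2 * r + 1) / 2 - r = (m + 1) / 2 := by omega
  rw [e1, e2]
  rcases Nat.even_or_odd' m with ⟨k, rfl | rfl⟩
  · have e3 : (2 * k) / 2 = k := by omega
    have e4 : (2 * k + 1) / 2 = k := by omega
    rw [e3, e4]
    nlinarith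
  · have e3 : (2 * k + 1) / 2 = k := by omega
    have e4 : (2 * k + 1 + 1) / 2 = k + 1 := by omega
    rw [e3, e4]
    nlinarith

theorem mul_le_of_add_eq {a b k e : ℕ} (he : e ≤ 1) (h : a + b = k + (k + e)) :
    a * b ≤ k * (k + e) ∧ (a * b = k * (k + e) → a = k ∨ a = k + e) := by
  rcases le_or_gt a k with hak | hak
  · obtain ⟨t, rfl⟩ := Nat.exists_eq_add_of_le hak
    obtain rfl : b = a + 2 * t + e := by omega
    refine ⟨by nlinarith, fun heq => ?_⟩
    have : t * (t + e) = 0 := by nlinarith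
    rcases Nat.mul_eq_zero.1 this with h0 | h0 <;> left <;> omega
  · obtain ⟨c, rfl⟩ : ∃ c, k = b + c := ⟨k - b, by omega⟩
    obtain rfl : a = b + 2 * c + e := by omega
    refine ⟨by nlinarith, fun heq => ?_⟩
    have : c * (c + e) = 0 := by nlinarith
    rcases Nat.mul_eq_zero.1 this with h0 | h0 <;> right <;> omega

/-- Among the blow-ups of `bipBase r` at the first vertices of the two paths, the balanced one has
the most arcs. -/
theorem pullback_le_extremal {V : Type*} [Fintype V] {n r a b : ℕ} (hr : 2 ≤ r)
    (hn : 2 * r ≤ n) (hab : a + b + 2 * r = n) (φ : V → Fin r ⊕ Fin r)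
    (hφ : ∀ x, (Finset.univ.filter (φ · = x)).card =
      1 + (if x = .inl ⟨0, by omega⟩ then a else 0) + (if x = .inr ⟨0, by omega⟩ then b else 0)) :
    size (pullback φ (bipBase r)) ≤ size (extremal n r) ∧
      (size (pullback φ (bipBase r)) = size (extremal n r) →
        Isomorphic (pullback φ (bipBase r)) (extremal n r)) := by
  classical
  rw [size_pullback_bipBase hr φ hφ, size_extremal hr hn]
  set a' := n / 2 - r with ha'
  set b' := (n + 1) / 2 - r with hb'
  have hsum : a + b = a' + b' := by omega
  have hle : a * b ≤ a' * b' ∧ (a * b = a' * b' → a = a' ∨ a = b') := by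
    obtain ⟨e, he, hb1⟩ : ∃ e, e ≤ 1 ∧ b' = a' + e := ⟨b' - a', by omega, by omega⟩
    rw [hb1] at hsum ⊢
    exact mul_le_of_add_eq he hsum
  refine ⟨by rw [hsum]; omega, fun heq => ?_⟩
  have hab' : a * b = a' * b' := by rw [hsum] at heq; omega
  rw [extremal_eq_pullback]
  have iso : ∀ ψ : V → Fin r ⊕ Fin r, (∀ x, (Finset.univ.filter (ψ · = x)).card =
      1 + (if x = .inl ⟨0, by omega⟩ then a' else 0) +
        (if x = .inr ⟨0, by omega⟩ then b' else 0)) →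
      Isomorphic (pullback ψ (bipBase r))
        (pullback (Sigma.fst : DVertex n r (balancedParam n r) → _) (bipBase r)) := by
    intro ψ hψ
    refine isomorphic_pullback fun x => ⟨Fintype.equivOfCardEq ?_⟩
    rw [Fintype.card_subtype, Fintype.card_subtype, hψ,
      ← card_fiber_extremal (by omega) hn x]
  rcases hle.2 hab' with h | h
  · obtain rfl : b = b' := by omega
    subst h
    exact iso φ hφ
  · obtain rfl : b = a' := by omega
    rw [← pullback_swap]
    refine iso _ fun x => ?_
    have hx : (Finset.univ.filter fun u => (φ u).swap = x) =
        Finset.univ.filter fun u => φ u = x.swap := by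
      ext u
      simp only [Finset.mem_filter, Finset.mem_univ, true_and]
      exact ⟨fun h => by rw [← h, Sum.swap_swap], fun h => by rw [h, Sum.swap_swap]⟩
    rw [hx, hφ, h]
    rcases x with x | x <;> simp

end DirectedGraph

namespace DirectedGraph

/-! ### Comparison of a skeleton with the extremal digraph -/

section skeleton

variable {V : Type*} {H : Digraph V} {r : ℕ} {S : Set V} {p q : V} {v w : ℕ → V}

namespace Skeleton

theorem swap (K : Skeleton H r S p q v w) : Skeleton H r Sᶜ q p w v where
  toHub := K.toHub.swap
  v_zero := K.w_zero
  w_zero := K.v_zero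
  adj_v := K.adj_w
  adj_w := K.adj_v
  pv := K.qw
  qv := K.pw
  qw := K.pv
  pw := K.qv
  outer_eq u hu := by
    rw [lev_comm] at hu
    obtain ⟨k, h1, h2, h3⟩ := K.outer_eq u hu
    exact ⟨k, h1, h2, h3.symm⟩
  ret_le u := by rw [ret_comm]; exact K.ret_le u
  ecc := K.ecc

theorem v_mem (K : Skeleton H r S p q v w) {k : ℕ} (hk : k < r) : v k ∈ S ↔ Even k := by
  rw [mem_iff_of_seq K.bip (n := r - 1) (fun i hi => K.adj_v i (by omega)) (by omega), K.v_zero]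
  simp [K.mem]

theorem w_mem (K : Skeleton H r S p q v w) {k : ℕ} (hk : k < r) : w k ∈ S ↔ ¬ Even k := by
  have := K.swap.v_mem hk
  rw [Set.mem_compl_iff] at this
  tauto

theorem lev_v (K : Skeleton H r S p q v w) {k : ℕ} (hk : k < r) : lev H p q (v k) = k := by
  simp only [lev, K.pv k hk, K.qv k hk]
  omega

theorem lev_w (K : Skeleton H r S p q v w) {k : ℕ} (hk : k < r) : lev H p q (w k) = k := by
  rw [lev_comm]
  exact K.swap.lev_v hk

theorem v_ne_w (K : Skeleton H r S p q v w) {i j : ℕ} (hi : i < r) (hj : j < r) :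
    v i ≠ w j := by
  intro h
  have h1 := K.pv i hi
  have h2 := K.qv i hi
  rw [h, K.pw j hj] at h1
  rw [h, K.qw j hj] at h2
  omega

theorem adj_p (K : Skeleton H r S p q v w) {u : V} (hu : u ∉ S) : H.Adj u p := by
  have h1 := K.ret_le u
  have h2 : ndist H u p ≤ 1 ∨ ndist H u q ≤ 1 := by simp only [ret] at h1; omega
  have hne : u ≠ p := fun h => hu (h ▸ K.mem)
  rcases h2 with h2 | h2
  · obtain ⟨x, hx, hd⟩ := K.conn.exists_first_step hne
    rwa [K.conn.eq_of_ndist_eq_zero (u := x) (v := p) (by omega)] at hx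
  · by_cases huq : u = q
    · exact huq ▸ K.qp
    · obtain ⟨x, hx, hd⟩ := K.conn.exists_first_step huq
      rw [K.conn.eq_of_ndist_eq_zero (u := x) (v := q) (by omega)] at hx
      exact absurd ((adj_mem_iff K.bip hx).2 hu) K.not_mem

theorem adj_q (K : Skeleton H r S p q v w) {u : V} (hu : u ∈ S) : H.Adj u q :=
  K.swap.adj_p (fun h => h hu)

theorem p_adj (K : Skeleton H r S p q v w) {u : V} (hu : u ∉ S) (hl : lev H p q u ≤ 1) :
    H.Adj p u := by
  have h2 : ndist H p u ≤ 1 ∨ ndist H q u ≤ 1 := by simp only [lev] at hl; omega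
  have hne : p ≠ u := fun h => hu (h ▸ K.mem)
  rcases h2 with h2 | h2
  · obtain ⟨x, hx, hd⟩ := K.conn.exists_first_step hne
    rwa [K.conn.eq_of_ndist_eq_zero (u := x) (v := u) (by omega)] at hx
  · by_cases huq : q = u
    · exact huq ▸ K.pq
    · obtain ⟨x, hx, hd⟩ := K.conn.exists_first_step huq
      rw [K.conn.eq_of_ndist_eq_zero (u := x) (v := u) (by omega)] at hx
      exact absurd ((adj_mem_iff K.bip hx).2 K.not_mem) hu

theorem q_adj (K : Skeleton H r S p q v w) {u : V} (hu : u ∈ S) (hl : lev H p q u ≤ 1) :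
    H.Adj q u :=
  K.swap.p_adj (fun h => h hu) (by rwa [lev_comm])

theorem ndist_v_v (K : Skeleton H r S p q v w) {i j : ℕ} (hij : i ≤ j) (hj : j < r) :
    ndist H (v i) (v j) ≤ j - i :=
  ndist_le_of_seq (n := r - 1) (fun i hi => K.adj_v i (by omega)) hij (by omega)

theorem ndist_w_w (K : Skeleton H r S p q v w) {i j : ℕ} (hij : i ≤ j) (hj : j < r) :
    ndist H (w i) (w j) ≤ j - i :=
  K.swap.ndist_v_v hij hj

/-- A vertex far from `x` lies on one of the two walks. -/
theorem exists_far (K : Skeleton H r S p q v w) (hr : 4 ≤ r) (x : V) :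
    ∃ k, 2 ≤ k ∧ k < r ∧ (r ≤ ndist H x (v k) ∨ r ≤ ndist H x (w k)) := by
  obtain ⟨y, hy⟩ := K.ecc x
  have h1 := K.toHub.ndist_le x y
  have h2 := K.ret_le x
  obtain ⟨k, hk2, hkr, rfl | rfl⟩ := K.outer_eq y (by omega)
  · exact ⟨k, hk2, hkr, .inl hy⟩
  · exact ⟨k, hk2, hkr, .inr hy⟩

/-- The vertex that is far from `v i` lies on the other walk. This uses that `r` is even. -/
theorem exists_far_v (K : Skeleton H r S p q v w) (hr : 4 ≤ r) (hre : Even r) {i : ℕ}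
    (hi : i < r) : ∃ k, 2 ≤ k ∧ k < r ∧ r ≤ ndist H (v i) (w k) := by
  rcases Nat.eq_zero_or_pos i with rfl | hi1
  · refine ⟨r - 1, by omega, by omega, ?_⟩
    rw [K.v_zero, K.pw _ (by omega)]
    omega
  obtain ⟨k, hk2, hkr, h | h⟩ := K.exists_far hr (v i)
  · exfalso
    rcases le_or_gt i k with hik | hik
    · have := K.ndist_v_v hik hkr
      omega
    · by_cases hie : Even i
      · have h1 := K.conn.ndist_le_one_add (K.adj_q ((K.v_mem hi).2 hie)) (v k)
        rw [K.qv k hkr] at h1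
        obtain ⟨a, ha⟩ := hie
        obtain ⟨b, hb⟩ := hre
        omega
      · have h1 := K.conn.ndist_le_one_add (K.adj_p fun h => hie ((K.v_mem hi).1 h)) (v k)
        rw [K.pv k hkr] at h1
        omega
  · exact ⟨k, hk2, hkr, h⟩

theorem le_ndist_v_w (K : Skeleton H r S p q v w) (hr : 4 ≤ r) (hre : Even r) {i : ℕ}
    (hi : i < r) (hie : Even i) : r ≤ ndist H (v i) (w (r - 1)) := by
  obtain ⟨k, hk2, hkr, h⟩ := K.exists_far_v hr hre hi
  have h1 := K.conn.ndist_le_one_add (K.adj_q ((K.v_mem hi).2 hie)) (w k)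
  rw [K.qw k hkr] at h1
  obtain rfl : k = r - 1 := by omega
  exact h

/-- There are no arcs from the first walk to the second one, except to its start `q`. For even `i`
the vertex `v i` reaches `q` in one step, so only `w (r - 1)` can be far from it, and a shortcut to
the second walk would bring it closer. For odd `i` the predecessor `v (i - 1)` has even index. -/
theorem not_adj_v_w (K : Skeleton H r S p q v w) (hr : 4 ≤ r) (hre : Even r) {i j : ℕ}
    (hi1 : 1 ≤ i) (hi : i < r) (hj1 : 1 ≤ j) (hj : j < r) : ¬ H.Adj (v i) (w j) := by
  intro h
  have h1 := K.conn.ndist_le_one_add h (w (r - 1))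
  have h2 := K.ndist_w_w (show j ≤ r - 1 by omega) (by omega)
  by_cases hie : Even i
  · have h3 := K.le_ndist_v_w hr hre hi hie
    omega
  · have h3 := K.le_ndist_v_w hr hre (i := i - 1) (by omega) (by grind)
    have h4 := K.adj_v (i - 1) (by omega)
    rw [show i - 1 + 1 = i by omega] at h4
    have h5 := K.conn.ndist_le_one_add h4 (w (r - 1))
    obtain rfl : j = 1 := by omega
    obtain ⟨k, hk2, hkr, h6⟩ := K.exists_far_v hr hre hi
    have h7 := K.conn.ndist_le_one_add h (w k)
    have h8 := K.ndist_w_w (show 1 ≤ k by omega) hkr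
    omega

/-- A vertex that, like `w 1`, has an arc to `w 2` reaches all `w k` quickly, so it must not reach
the `v k` quickly as well, and `v 1` must not reach the `w k` through it. -/
theorem not_adj_of_adj_w_two (K : Skeleton H r S p q v w) (hr : 4 ≤ r) (hre : Even r) {x : V}
    (hx : H.Adj x (w 2)) : ¬ H.Adj x (v 1) ∧ ¬ H.Adj (v 1) x := by
  constructor <;> intro h
  · obtain ⟨k, hk2, hkr, h1 | h1⟩ := K.exists_far hr x
    · have h2 := K.conn.ndist_le_one_add h (v k)
      have h3 := K.ndist_v_v (show 1 ≤ k by omega) hkr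
      omega
    · have h2 := K.conn.ndist_le_one_add hx (w k)
      have h3 := K.ndist_w_w hk2 hkr
      omega
  · obtain ⟨k, hk2, hkr, h1⟩ := K.exists_far_v hr hre (i := 1) (by omega)
    have h2 := K.conn.ndist_le_one_add h (w k)
    have h3 := K.conn.ndist_le_one_add hx (w k)
    have h4 := K.ndist_w_w hk2 hkr
    omega

end Skeleton

/-- A labelling of the vertices by those of the base digraph: the two walks get their own labels
from their second vertices on, and all remaining vertices get the label of the first vertex of
their class. -/
structure IsLabel (H : Digraph V) (S : Set V) (p q : V) (v w : ℕ → V)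
    (φ : V → Fin r ⊕ Fin r) : Prop where
  inl : ∀ u i, φ u = .inl i → (i.val = 0 ∧ u ∈ S ∧ lev H p q u ≤ 1) ∨ (1 ≤ i.val ∧ u = v i)
  inr : ∀ u i, φ u = .inr i → (i.val = 0 ∧ u ∉ S ∧ lev H p q u ≤ 1) ∨ (1 ≤ i.val ∧ u = w i)
  map_v : ∀ k (hk : k < r), 1 ≤ k → φ (v k) = .inl ⟨k, hk⟩
  map_w : ∀ k (hk : k < r), 1 ≤ k → φ (w k) = .inr ⟨k, hk⟩

theorem Skeleton.exists_label (K : Skeleton H r S p q v w) (hr : 0 < r) :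
    ∃ φ : V → Fin r ⊕ Fin r, IsLabel H S p q v w φ := by
  classical
  let P : V → Prop := fun u => ∃ k, k < r ∧ 1 ≤ k ∧ u = v k
  let Q : V → Prop := fun u => ∃ k, k < r ∧ 1 ≤ k ∧ u = w k
  let φ : V → Fin r ⊕ Fin r := fun u =>
    if h : P u then .inl ⟨h.choose, h.choose_spec.1⟩
    else if h : Q u then .inr ⟨h.choose, h.choose_spec.1⟩
    else if u ∈ S then .inl ⟨0, hr⟩ else .inr ⟨0, hr⟩
  have hlev : ∀ u, ¬ P u → ¬ Q u → lev H p q u ≤ 1 := by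
    intro u hP hQ
    by_contra hl
    obtain ⟨k, hk2, hkr, h | h⟩ := K.outer_eq u (by omega)
    · exact hP ⟨k, hkr, by omega, h⟩
    · exact hQ ⟨k, hkr, by omega, h⟩
  refine ⟨φ, ?_, ?_, ?_, ?_⟩
  · intro u i hu
    simp only [φ] at hu
    split_ifs at hu with h1 h2 h3
    · cases hu
      exact .inr h1.choose_spec.2
    · cases hu
      exact .inl ⟨rfl, h3, hlev u h1 h2⟩
  · intro u i hu
    simp only [φ] at hu
    split_ifs at hu with h1 h2 h3
    · cases hu
      exact .inr h2.choose_spec.2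
    · cases hu
      exact .inl ⟨rfl, h3, hlev u h1 h2⟩
  · intro k hk hk1
    have h1 : P (v k) := ⟨k, hk, hk1, rfl⟩
    simp only [φ, dif_pos h1, Sum.inl.injEq, Fin.mk.injEq]
    rw [← K.lev_v h1.choose_spec.1, ← h1.choose_spec.2.2, K.lev_v hk]
  · intro k hk hk1
    have h1 : Q (w k) := ⟨k, hk, hk1, rfl⟩
    have h2 : ¬ P (w k) := fun ⟨j, hj, _, h⟩ => K.v_ne_w hj hk h.symm
    simp only [φ, dif_neg h2, dif_pos h1, Sum.inr.injEq, Fin.mk.injEq]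
    rw [← K.lev_w h1.choose_spec.1, ← h1.choose_spec.2.2, K.lev_w hk]

namespace IsLabel

variable {φ : V → Fin r ⊕ Fin r}

theorem swap (hφ : IsLabel H S p q v w φ) :
    IsLabel H Sᶜ q p w v (fun u => (φ u).swap) where
  inl u i hu := by
    rw [lev_comm]
    exact hφ.inr u i (by rw [← Sum.swap_swap (φ u), hu, Sum.swap_inl])
  inr u i hu := by
    rw [lev_comm, Set.mem_compl_iff, not_not]
    exact hφ.inl u i (by rw [← Sum.swap_swap (φ u), hu, Sum.swap_inr])
  map_v k hk hk1 := by rw [hφ.map_w k hk hk1, Sum.swap_inr]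
  map_w k hk hk1 := by rw [hφ.map_v k hk hk1, Sum.swap_inl]

theorem mem_iff_of_inl (hφ : IsLabel H S p q v w φ) (K : Skeleton H r S p q v w) {u : V}
    {i : Fin r} (hu : φ u = .inl i) : u ∈ S ↔ Even i.val := by
  rcases hφ.inl u i hu with ⟨h1, h2, -⟩ | ⟨-, rfl⟩
  · simp [h1, h2]
  · exact K.v_mem i.2

theorem mem_iff_of_inr (hφ : IsLabel H S p q v w φ) (K : Skeleton H r S p q v w) {u : V}
    {i : Fin r} (hu : φ u = .inr i) : u ∈ S ↔ ¬ Even i.val := by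
  rcases hφ.inr u i hu with ⟨h1, h2, -⟩ | ⟨-, rfl⟩
  · simp [h1, h2]
  · exact K.w_mem i.2

/-- An arc that leaves a vertex labelled by the first walk is mapped to an arc of the base digraph,
unless it goes from a vertex with the label of the first vertex `v₁` to `w 2`. -/
theorem adj_of_inl (hφ : IsLabel H S p q v w φ) (K : Skeleton H r S p q v w) (hr : 4 ≤ r)
    (hre : Even r) {x y : V} (hxy : H.Adj x y) {i : Fin r} (hx : φ x = .inl i) :
    (bipBase r).Adj (φ x) (φ y) ∨ (i.val = 0 ∧ y = w 2) := by
  have hS := adj_mem_iff K.bip hxy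
  have hiS := hφ.mem_iff_of_inl K hx
  have hp := K.conn.ndist_le_add_one p hxy
  have hq := K.conn.ndist_le_add_one q hxy
  rcases hy : φ y with j | j
  · left
    have hjS := hφ.mem_iff_of_inl K hy
    rw [hx, bipBase_inl_inl]
    refine ⟨?_, by tauto⟩
    rcases hφ.inl y j hy with ⟨hj, -⟩ | ⟨hj, rfl⟩
    · omega
    rw [K.pv j j.2] at hp
    rw [K.qv j j.2] at hq
    rcases hφ.inl x i hx with ⟨hi, hxS, hxl⟩ | ⟨hi, rfl⟩
    · have := ndist_le_one (K.q_adj hxS hxl)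
      omega
    · rw [K.pv i i.2] at hp
      exact hp
  · have hjS := hφ.mem_iff_of_inr K hy
    rcases hφ.inr y j hy with ⟨hj, hyS, -⟩ | ⟨hj, rfl⟩
    · left
      rw [hx, bipBase_inl_inr]
      exact ⟨hj, by tauto⟩
    · right
      rcases hφ.inl x i hx with ⟨hi, hxS, hxl⟩ | ⟨hi, rfl⟩
      · have h1 := ndist_le_one (K.q_adj hxS hxl)
        rw [K.qw j j.2] at hq
        have h2 : j.val ≠ 1 := by
          intro h
          exact hS.1 (hjS.2 (by rw [h]; decide)) hxS
        rw [show j.val = 2 by omega]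
        exact ⟨hi, rfl⟩
      · exact absurd hxy (K.not_adj_v_w hr hre hi i.2 hj j.2)

/-- The exceptional arcs of `H`, those that are not mapped to arcs of the base digraph. -/
theorem exceptional (hφ : IsLabel H S p q v w φ) (K : Skeleton H r S p q v w) (hr : 4 ≤ r)
    (hre : Even r) {x y : V} (hxy : H.Adj x y) (hn : ¬ (bipBase r).Adj (φ x) (φ y)) :
    (φ x = .inl ⟨0, by omega⟩ ∧ y = w 2) ∨ (φ x = .inr ⟨0, by omega⟩ ∧ y = v 2) := by
  rcases hx : φ x with i | i
  · rcases hφ.adj_of_inl K hr hre hxy hx with h | ⟨h1, h2⟩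
    · exact absurd h hn
    · exact .inl ⟨congrArg _ (Fin.ext h1), h2⟩
  · have hx' : (φ x).swap = .inl i := by rw [hx, Sum.swap_inr]
    rcases hφ.swap.adj_of_inl K.swap hr hre hxy hx' with h | ⟨h1, h2⟩
    · exact absurd ((bipBase_swap _ _).1 h) hn
    · exact .inr ⟨congrArg _ (Fin.ext h1), h2⟩

/-- Trading exceptional arcs for arcs of the pullback: an exceptional arc from `x` to `w 2`
excludes the two arcs between `x` and `v 1`. -/
theorem trade (hφ : IsLabel H S p q v w φ) (K : Skeleton H r S p q v w) (hr : 4 ≤ r)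
    (hre : Even r) {x : V} (hx : φ x = .inl ⟨0, by omega⟩) (hxw : H.Adj x (w 2)) :
    ((pullback φ (bipBase r)).Adj x (v 1) ∧ ¬ H.Adj x (v 1)) ∧
      ((pullback φ (bipBase r)).Adj (v 1) x ∧ ¬ H.Adj (v 1) x) := by
  have h := K.not_adj_of_adj_w_two hr hre hxw
  have h1 := hφ.map_v 1 (by omega) le_rfl
  refine ⟨⟨?_, h.1⟩, ?_, h.2⟩ <;> simp [pullback, hx, h1, bipBase_inl_inl]

theorem trade' (hφ : IsLabel H S p q v w φ) (K : Skeleton H r S p q v w) (hr : 4 ≤ r)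
    (hre : Even r) {x : V} (hx : φ x = .inr ⟨0, by omega⟩) (hxv : H.Adj x (v 2)) :
    ((pullback φ (bipBase r)).Adj x (w 1) ∧ ¬ H.Adj x (w 1)) ∧
      ((pullback φ (bipBase r)).Adj (w 1) x ∧ ¬ H.Adj (w 1) x) := by
  have := hφ.swap.trade K.swap hr hre (by rw [hx, Sum.swap_inr]) hxv
  rwa [pullback_swap] at this

/-- A digraph with a skeleton has at most as many arcs as the pullback along a labelling. Mapping
the exceptional arcs `(x, w 2)` to `(x, v 1)`, and symmetrically, is injective into the arcs that
only the pullback has, and misses `(v 1, x)`. -/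
theorem size_le [Fintype V] (hφ : IsLabel H S p q v w φ) (K : Skeleton H r S p q v w)
    (hr : 4 ≤ r) (hre : Even r) :
    size H ≤ size (pullback φ (bipBase r)) ∧
      (size H = size (pullback φ (bipBase r)) → H = pullback φ (bipBase r)) := by
  classical
  set E := pullback φ (bipBase r) with hE
  let A : Set (V × V) := {a | H.Adj a.1 a.2}
  let B : Set (V × V) := {a | E.Adj a.1 a.2}
  have hA : A.ncard = size H := rfl
  have hB : B.ncard = size E := rfl
  let g : V × V → V × V := fun a => (a.1, if a.2 = w 2 then v 1 else w 1)
  have hvw2 : v 2 ≠ w 2 := K.v_ne_w (by omega) (by omega)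
  have exc : ∀ a ∈ A \ B, (φ a.1 = .inl ⟨0, by omega⟩ ∧ a.2 = w 2 ∧ (g a).2 = v 1) ∨
      (φ a.1 = .inr ⟨0, by omega⟩ ∧ a.2 = v 2 ∧ (g a).2 = w 1) := by
    intro a ha
    rcases hφ.exceptional K hr hre ha.1 ha.2 with ⟨h1, h2⟩ | ⟨h1, h2⟩
    · exact .inl ⟨h1, h2, if_pos h2⟩
    · exact .inr ⟨h1, h2, if_neg (h2 ▸ hvw2)⟩
  have hmaps : ∀ a ∈ A \ B, g a ∈ B \ A ∧ ∃ b ∈ B \ A, b.2 = a.1 := by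
    intro a ha
    have ha1 : H.Adj a.1 a.2 := ha.1
    rcases exc a ha with ⟨h1, h2, h3⟩ | ⟨h1, h2, h3⟩
    · rw [h2] at ha1
      have := hφ.trade K hr hre h1 ha1
      rw [show g a = (a.1, v 1) from Prod.ext rfl h3]
      exact ⟨this.1, (v 1, a.1), this.2, rfl⟩
    · rw [h2] at ha1
      have := hφ.trade' K hr hre h1 ha1
      rw [show g a = (a.1, w 1) from Prod.ext rfl h3]
      exact ⟨this.1, (w 1, a.1), this.2, rfl⟩
  have hinj : Set.InjOn g (A \ B) := by
    intro a ha b hb hab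
    have e1 : a.1 = b.1 := (Prod.ext_iff.1 hab).1
    refine Prod.ext e1 ?_
    rcases exc a ha with ⟨h1, h2, -⟩ | ⟨h1, h2, -⟩ <;>
      rcases exc b hb with ⟨h3, h4, -⟩ | ⟨h3, h4, -⟩
    · rw [h2, h4]
    · rw [e1, h3] at h1; simp at h1
    · rw [e1, h3] at h1; simp at h1
    · rw [h2, h4]
  have hle : (A \ B).ncard ≤ (B \ A).ncard :=
    Set.ncard_le_ncard_of_injOn g (fun a ha => (hmaps a ha).1) hinj
  have hlt : (A \ B).Nonempty → (A \ B).ncard < (B \ A).ncard := by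
    rintro ⟨a, ha⟩
    obtain ⟨b, hb, hba⟩ := (hmaps a ha).2
    rw [← hinj.ncard_image]
    refine Set.ncard_lt_ncard ⟨?_, fun hsub => ?_⟩ (Set.toFinite _)
    · rintro _ ⟨c, hc, rfl⟩
      exact (hmaps c hc).1
    · obtain ⟨c, hc, hcb⟩ := hsub hb
      have e : (g c).2 = a.1 := by rw [hcb, hba]
      have hv1 := hφ.map_v 1 (by omega) le_rfl
      have hw1 := hφ.map_w 1 (by omega) le_rfl
      rcases exc a ha with ⟨h1, -⟩ | ⟨h1, -⟩ <;> rcases exc c hc with ⟨-, -, h3⟩ | ⟨-, -, h3⟩ <;>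
        rw [← e, h3] at h1 <;> simp [hv1, hw1] at h1
  have e1 := Set.ncard_inter_add_ncard_sdiff_eq_ncard A B
  have e2 := Set.ncard_inter_add_ncard_sdiff_eq_ncard B A
  rw [Set.inter_comm] at e2
  refine ⟨by omega, fun heq => ?_⟩
  have h0 : A \ B = ∅ := by
    by_contra hne
    have := hlt (Set.nonempty_iff_ne_empty.2 hne)
    omega
  have h1 : A = B := Set.eq_of_subset_of_ncard_le (Set.sdiff_eq_empty.1 h0) (by omega)
  ext x y
  exact Set.ext_iff.1 h1 (x, y)

theorem card_fiber [Fintype V] (hφ : IsLabel H S p q v w φ) (K : Skeleton H r S p q v w)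
    (hr : 0 < r) : ∃ a b, a + b + 2 * r = Fintype.card V ∧
      ∀ x, (Finset.univ.filter (φ · = x)).card =
        1 + (if x = .inl ⟨0, hr⟩ then a else 0) + (if x = .inr ⟨0, hr⟩ then b else 0) := by
  classical
  have hinl : ∀ k (hk : k < r), 1 ≤ k → (Finset.univ.filter (φ · = .inl ⟨k, hk⟩)).card = 1 := by
    intro k hk hk1
    rw [Finset.card_eq_one]
    refine ⟨v k, ?_⟩
    ext u
    simp only [Finset.mem_filter, Finset.mem_univ, true_and, Finset.mem_singleton]
    refine ⟨fun hu => ?_, fun hu => hu ▸ hφ.map_v k hk hk1⟩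
    rcases hφ.inl u _ hu with ⟨h0, -⟩ | ⟨-, h⟩
    · simp only at h0; omega
    · exact h
  have hinr : ∀ k (hk : k < r), 1 ≤ k → (Finset.univ.filter (φ · = .inr ⟨k, hk⟩)).card = 1 := by
    intro k hk hk1
    rw [Finset.card_eq_one]
    refine ⟨w k, ?_⟩
    ext u
    simp only [Finset.mem_filter, Finset.mem_univ, true_and, Finset.mem_singleton]
    refine ⟨fun hu => ?_, fun hu => hu ▸ hφ.map_w k hk hk1⟩
    rcases hφ.inr u _ hu with ⟨h0, -⟩ | ⟨-, h⟩
    · simp only at h0; omega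
    · exact h
  have hp : φ p = .inl ⟨0, hr⟩ := by
    have hp0 := ndist_self H p
    rcases h : φ p with i | i
    · rcases hφ.inl p i h with ⟨h0, -⟩ | ⟨h1, h2⟩
      · exact congrArg _ (Fin.ext h0)
      · have := K.pv i i.2
        rw [← h2] at this
        omega
    · rcases hφ.inr p i h with ⟨-, h0, -⟩ | ⟨h1, h2⟩
      · exact absurd K.mem h0
      · have := K.pw i i.2
        rw [← h2] at this
        omega
  have hq : φ q = .inr ⟨0, hr⟩ := by
    have hq0 := ndist_self H q
    rcases h : φ q with i | i
    · rcases hφ.inl q i h with ⟨-, h0, -⟩ | ⟨h1, h2⟩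
      · exact absurd h0 K.not_mem
      · have := K.qv i i.2
        rw [← h2] at this
        omega
    · rcases hφ.inr q i h with ⟨h0, -⟩ | ⟨h1, h2⟩
      · exact congrArg _ (Fin.ext h0)
      · have := K.qw i i.2
        rw [← h2] at this
        omega
  have hcp : 0 < (Finset.univ.filter (φ · = .inl ⟨0, hr⟩)).card :=
    Finset.card_pos.2 ⟨p, by simp [hp]⟩
  have hcq : 0 < (Finset.univ.filter (φ · = .inr ⟨0, hr⟩)).card :=
    Finset.card_pos.2 ⟨q, by simp [hq]⟩
  set a := (Finset.univ.filter (φ · = .inl ⟨0, hr⟩)).card - 1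
  set b := (Finset.univ.filter (φ · = .inr ⟨0, hr⟩)).card - 1
  have hall : ∀ x, (Finset.univ.filter (φ · = x)).card =
      1 + (if x = .inl ⟨0, hr⟩ then a else 0) + (if x = .inr ⟨0, hr⟩ then b else 0) := by
    rintro (⟨k, hk⟩ | ⟨k, hk⟩) <;> rcases Nat.eq_zero_or_pos k with rfl | hk1
    · simp only [reduceCtorEq, if_true, if_false]; omega
    · rw [hinl k hk hk1]
      simp [hk1.ne']
    · simp only [reduceCtorEq, if_true, if_false]; omega
    · rw [hinr k hk hk1]
      simp [hk1.ne']
  refine ⟨a, b, ?_, hall⟩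
  have htot := Finset.card_eq_sum_card_fiberwise (f := φ) (s := Finset.univ) (t := Finset.univ)
    (fun _ _ => Finset.mem_coe.2 (Finset.mem_univ _))
  rw [Finset.sum_congr rfl fun x _ => hall x, Finset.sum_add_distrib, Finset.sum_add_distrib,
    Finset.sum_ite_eq', Finset.sum_ite_eq'] at htot
  simp only [Finset.card_univ, Finset.sum_const, Fintype.card_sum, Fintype.card_fin,
    Finset.mem_univ, if_true, smul_eq_mul] at htot
  omega

end IsLabel

theorem Skeleton.size_le_extremal [Fintype V] (K : Skeleton H r S p q v w) (hr : 4 ≤ r)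
    (hre : Even r) : size H ≤ size (extremal (Fintype.card V) r) ∧
      (size H = size (extremal (Fintype.card V) r) →
        Isomorphic H (extremal (Fintype.card V) r)) := by
  obtain ⟨φ, hφ⟩ := K.exists_label (by omega)
  obtain ⟨a, b, hab, hfib⟩ := hφ.card_fiber K (by omega)
  obtain ⟨h1, h2⟩ := hφ.size_le K hr hre
  obtain ⟨h3, h4⟩ := pullback_le_extremal (by omega) (by omega) hab φ hfib
  refine ⟨h1.trans h3, fun heq => ?_⟩
  rw [h2 (by omega)]
  exact h4 (by omega)

end skeleton

end DirectedGraph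

namespace DirectedGraph

/-! ### Completing the arcs between a pair and a core -/

section core

variable {V : Type*} {D : Digraph V} {S C : Set V} {p q : V}

/-- The digraph obtained from `D` by adding all arcs, in both directions, between `p` and `q` and
the vertices of `C` in the opposite class. -/
def addHub (D : Digraph V) (S C : Set V) (p q : V) : Digraph V where
  Adj u v := D.Adj u v ∨ ((completeBipartite S).Adj u v ∧
    (((u = p ∨ u = q) ∧ v ∈ C) ∨ (u ∈ C ∧ (v = p ∨ v = q))))

/-- The conditions on a bidirected edge between `p` and `q`, both in a core `C` of `D`, under which
adding the missing arcs between the core and `{p, q}` has little effect on large distances. The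
predicate `far` marks the vertices with few in-neighbours in the core: `not_far` says that `p` and
`q` have no arcs to them, `not_exit` that `p` and `q` are joined to all core vertices that do. -/
structure CorePair (D : Digraph V) (S C : Set V) (far : V → Prop) (p q : V) : Prop
    extends Hub D S p q where
  p_mem : p ∈ C
  q_mem : q ∈ C
  near : ∀ b ∈ C, ∀ u, ¬ far u → (b ∈ S ↔ u ∈ S) → ndist D b u ≤ 2
  not_far : ∀ a, a = p ∨ a = q → ∀ g, D.Adj a g → ¬ far g
  not_exit : ∀ a, a = p ∨ a = q → ∀ c ∈ C, (completeBipartite S).Adj a c →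
    D.Adj a c ∨ ∀ s, D.Adj c s → ¬ far s
  back : ∀ a, a = p ∨ a = q → ∀ x, D.Adj x a → ∀ y ∈ C, ndist D x y ≤ 3
  core : ∀ x ∈ C, ∀ y ∈ C, ndist D x y ≤ 3

theorem le_addHub (D : Digraph V) (S C : Set V) (p q : V) : D ≤ addHub D S C p q :=
  fun {_ _} h => .inl h

theorem completeBipartite_adj_comm {u v : V} :
    (completeBipartite S).Adj u v ↔ (completeBipartite S).Adj v u := by
  simp only [completeBipartite]
  tauto

namespace CorePair

variable {far : V → Prop}

theorem hub_addHub (h : CorePair D S C far p q) : Hub (addHub D S C p q) S p q where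
  bip := by
    rintro u v (huv | huv)
    · exact h.bip huv
    · exact huv.1
  conn := h.conn.mono (le_addHub D S C p q)
  mem := h.mem
  not_mem := h.not_mem
  pq := .inl h.pq
  qp := .inl h.qp

/-- The distance in `D` to a vertex `y` outside the core drops by at most one along every arc of
`addHub D S C p q`. -/
theorem ndist_le_of_adj (h : CorePair D S C far p q) {y : V} (hy : y ∉ C) {u v : V}
    (huv : (addHub D S C p q).Adj u v) : ndist D u y ≤ ndist D v y + 1 := by
  have hC : ∀ a, a = p ∨ a = q → a ∈ C := by
    rintro a (rfl | rfl)
    · exact h.p_mem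
    · exact h.q_mem
  rcases huv with huv | ⟨hop, ⟨hu, hv⟩ | ⟨hu, hv⟩⟩
  · have := h.conn.ndist_le_one_add huv y
    omega
  -- The second vertex of a walk that starts with an added arc is not far, hence it is reached from
  -- `u` in two steps of `D`.
  · rcases h.not_exit u hu v hv hop with huv | hex
    · have := h.conn.ndist_le_one_add huv y
      omega
    · obtain ⟨s, hs, hd⟩ := h.conn.exists_first_step (u := v) (v := y) (fun e => hy (e ▸ hv))
      have h1 : u ∈ S ↔ s ∈ S := by
        have h2 := adj_mem_iff h.bip hs
        have h3 := adj_mem_iff le_rfl hop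
        tauto
      have h2 := h.near u (hC u hu) s (hex s hs) h1
      have h3 := h.conn.ndist_triangle u s y
      omega
  · obtain ⟨g, hg, hd⟩ := h.conn.exists_first_step (u := v) (v := y) (fun e => hy (e ▸ hC v hv))
    have h1 : u ∈ S ↔ g ∈ S := by
      have h2 := adj_mem_iff h.bip hg
      have h3 := adj_mem_iff le_rfl hop
      tauto
    have h2 := h.near u hu g (h.not_far v hv g hg) h1
    have h3 := h.conn.ndist_triangle u g y
    omega

theorem ndist_le_addHub (h : CorePair D S C far p q) {y : V} (hy : y ∉ C) (x : V) :
    ndist D x y ≤ ndist (addHub D S C p q) x y := by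
  have key : ∀ k x, HasWalk (addHub D S C p q) k x y → ndist D x y ≤ k := by
    intro k
    induction k with
    | zero =>
      rintro x rfl
      simp [ndist_self]
    | succ k ih =>
      rintro x ⟨z, hxz, hz⟩
      have := h.ndist_le_of_adj hy hxz
      have := ih z hz
      omega
  exact key _ x (h.hub_addHub.conn.hasWalk_ndist x y)

/-- A vertex from which some core vertex is far needs a long way to the pair `{p, q}`, as every
vertex with an arc of `D` to the pair is within distance three of every core vertex. -/
theorem ndist_le_ret (h : CorePair D S C far p q) {y : V} (hy : y ∈ C) (x : V) :
    ndist D x y ≤ max (ret (addHub D S C p q) p q x + 2) 3 := by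
  have key : ∀ a, a = p ∨ a = q → ∀ k x, HasWalk (addHub D S C p q) k x a →
      ndist D x y ≤ max (k + 2) 3 := by
    intro a ha k
    have haC : a ∈ C := by
      rcases ha with rfl | rfl
      · exact h.p_mem
      · exact h.q_mem
    induction k with
    | zero =>
      rintro x rfl
      exact (h.core _ haC y hy).trans (le_max_right _ _)
    | succ k ih =>
      rintro x ⟨z, hxz, hz⟩
      rcases hxz with hxz | ⟨-, ⟨hx, -⟩ | ⟨hx, -⟩⟩
      · have h1 := h.conn.ndist_le_one_add hxz y
        have h2 := ih z hz
        rcases Nat.eq_zero_or_pos k with rfl | hk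
        · obtain rfl : z = a := hz
          exact (h.back z ha x hxz y hy).trans (le_max_right _ _)
        · omega
      · have hxC : x ∈ C := by
          rcases hx with rfl | rfl
          · exact h.p_mem
          · exact h.q_mem
        exact (h.core _ hxC y hy).trans (le_max_right _ _)
      · exact (h.core _ hx y hy).trans (le_max_right _ _)
  rcases le_total (ndist (addHub D S C p q) x p) (ndist (addHub D S C p q) x q) with hle | hle
  · rw [ret, min_eq_left hle]
    exact key p (.inl rfl) _ x (h.hub_addHub.conn.hasWalk_ndist x p)
  · rw [ret, min_eq_right hle]
    exact key q (.inr rfl) _ x (h.hub_addHub.conn.hasWalk_ndist x q)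

theorem exists_far_or_ret (h : CorePair D S C far p q) {r : ℕ} (hr : 4 ≤ r)
    (hecc : ∀ x, ∃ y, r ≤ ndist D x y) (x : V) :
    (∃ y, r ≤ ndist (addHub D S C p q) x y) ∨ r ≤ ret (addHub D S C p q) p q x + 2 := by
  obtain ⟨y, hy⟩ := hecc x
  by_cases hyC : y ∈ C
  · right
    have := h.ndist_le_ret hyC x
    omega
  · exact .inl ⟨y, hy.trans (h.ndist_le_addHub hyC x)⟩

theorem not_adj_of_outer (h : CorePair D S C far p q) {u : V}
    (hu : 2 ≤ lev (addHub D S C p q) p q u) :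
    u ∉ C ∧ ((u ∈ S ∧ ¬ D.Adj q u) ∨ (u ∉ S ∧ ¬ D.Adj p u)) := by
  have hn : ∀ a, a = p ∨ a = q → ¬ (addHub D S C p q).Adj a u := by
    rintro a ha hau
    have := ndist_le_one hau
    rcases ha with rfl | rfl <;> simp only [lev] at hu <;> omega
  have hp := hn p (.inl rfl)
  have hq := hn q (.inr rfl)
  have hpS := h.mem
  have hqS := h.not_mem
  simp only [addHub, completeBipartite] at hp hq
  tauto

theorem not_adj_of_slow (h : CorePair D S C far p q) {u : V}
    (hu : 2 ≤ ret (addHub D S C p q) p q u) :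
    u ∉ C ∧ ((u ∈ S ∧ ¬ D.Adj u q) ∨ (u ∉ S ∧ ¬ D.Adj u p)) := by
  have hn : ∀ a, a = p ∨ a = q → ¬ (addHub D S C p q).Adj u a := by
    rintro a ha hau
    have := ndist_le_one hau
    rcases ha with rfl | rfl <;> simp only [ret] at hu <;> omega
  have hp := hn p (.inl rfl)
  have hq := hn q (.inr rfl)
  have hpS := h.mem
  have hqS := h.not_mem
  simp only [addHub, completeBipartite] at hp hq
  tauto

end CorePair

open Classical in
/-- The number of arcs missing between `b` and the vertices of the other class outside `C`. -/
noncomputable def coreCost [Fintype V] (D : Digraph V) (S C : Set V) (b : V) : ℕ :=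
  (Finset.univ.filter fun u => u ∉ C ∧ (completeBipartite S).Adj b u ∧ ¬ D.Adj b u).card +
    (Finset.univ.filter fun u => u ∉ C ∧ (completeBipartite S).Adj b u ∧ ¬ D.Adj u b).card

theorem CorePair.card_le [Fintype V] {far : V → Prop} (h : CorePair D S C far p q) :
    (outer (addHub D S C p q) p q).card + (slow (addHub D S C p q) p q).card ≤
      coreCost D S C p + coreCost D S C q := by
  classical
  have hpS := h.mem
  have hqS := h.not_mem
  have h1 : (outer (addHub D S C p q) p q).card ≤
      (Finset.univ.filter fun u => u ∉ C ∧ (completeBipartite S).Adj p u ∧ ¬ D.Adj p u).card +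
      (Finset.univ.filter fun u => u ∉ C ∧ (completeBipartite S).Adj q u ∧ ¬ D.Adj q u).card := by
    refine (Finset.card_le_card fun u hu => ?_).trans (Finset.card_union_le _ _)
    have := h.not_adj_of_outer (mem_outer.1 hu)
    rw [Finset.mem_union, Finset.mem_filter, Finset.mem_filter]
    simp only [Finset.mem_univ, true_and, completeBipartite]
    tauto
  have h2 : (slow (addHub D S C p q) p q).card ≤
      (Finset.univ.filter fun u => u ∉ C ∧ (completeBipartite S).Adj p u ∧ ¬ D.Adj u p).card +
      (Finset.univ.filter fun u => u ∉ C ∧ (completeBipartite S).Adj q u ∧ ¬ D.Adj u q).card := by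
    refine (Finset.card_le_card fun u hu => ?_).trans (Finset.card_union_le _ _)
    have := h.not_adj_of_slow (mem_slow.1 hu)
    rw [Finset.mem_union, Finset.mem_filter, Finset.mem_filter]
    simp only [Finset.mem_univ, true_and, completeBipartite]
    tauto
  simp only [coreCost]
  omega

theorem size_mono [Finite V] {E : Digraph V} (h : D ≤ E) :
    size D ≤ size E ∧ (size D = size E → D = E) := by
  have hsub : {a : V × V | D.Adj a.1 a.2} ⊆ {a | E.Adj a.1 a.2} := fun a ha => h ha
  refine ⟨Set.ncard_le_ncard hsub (Set.toFinite _), fun heq => ?_⟩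
  have := Set.eq_of_subset_of_ncard_le hsub heq.ge (Set.toFinite _)
  ext x y
  exact Set.ext_iff.1 this (x, y)

/-- Completing the arcs between the pair and the core yields a digraph with a skeleton, whose size
is bounded by that of the extremal digraph. If `D` has at least that size, then no arc was added. -/
theorem CorePair.isomorphic_extremal [Fintype V] {far : V → Prop} {r : ℕ} (hr : 4 ≤ r)
    (hre : Even r) (h : CorePair D S C far p q) (hecc : ∀ x, ∃ y, r ≤ ndist D x y)
    (hcost : coreCost D S C p + coreCost D S C q + 4 ≤ 2 * r)
    (hsize : size (extremal (Fintype.card V) r) ≤ size D) :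
    Isomorphic D (extremal (Fintype.card V) r) := by
  have hcard := h.card_le
  obtain ⟨v, w, K⟩ := h.hub_addHub.exists_skeleton hr (h.exists_far_or_ret hr hecc) (by omega)
  obtain ⟨h1, h2⟩ := K.size_le_extremal hr hre
  obtain ⟨h3, h4⟩ := size_mono (le_addHub D S C p q)
  have h5 := h2 (by omega)
  rwa [← h4 (by omega)] at h5

end core

end DirectedGraph

namespace DirectedGraph

/-! ### Missing arcs and the choice of a core pair -/

section missing

variable {V : Type*} {D : Digraph V} {S : Set V}

/-- An ordered pair of vertices of different classes that is not an arc. -/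
def Missing (D : Digraph V) (S : Set V) (u v : V) : Prop :=
  (completeBipartite S).Adj u v ∧ ¬ D.Adj u v

theorem completeBipartite_adj_iff {u v : V} :
    (completeBipartite S).Adj u v ↔ (v ∈ S ↔ u ∉ S) := by
  simp only [completeBipartite]
  tauto

theorem ndist_le_two {u v w : V} (huv : D.Adj u v) (hvw : D.Adj v w) : ndist D u w ≤ 2 :=
  ndist_le ⟨v, huv, w, hvw, rfl⟩

variable [Fintype V]

open Classical in
/-- The number of missing pairs. -/
noncomputable def missing (D : Digraph V) (S : Set V) : ℕ :=
  (Finset.univ.filter fun a : V × V => Missing D S a.1 a.2).card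

open Classical in
/-- The number of missing pairs containing `u`. -/
noncomputable def missDeg (D : Digraph V) (S : Set V) (u : V) : ℕ :=
  (Finset.univ.filter fun v => Missing D S u v).card +
    (Finset.univ.filter fun v => Missing D S v u).card

open Classical in
/-- The vertices in at most `k` missing pairs. -/
noncomputable def coreSet (D : Digraph V) (S : Set V) (k : ℕ) : Finset V :=
  Finset.univ.filter fun u => missDeg D S u ≤ k

open Classical in
/-- The vertices with at most `k` in-neighbours in the core. -/
noncomputable def farSet (D : Digraph V) (S : Set V) (k : ℕ) : Finset V :=
  Finset.univ.filter fun u => ((coreSet D S k).filter fun c => D.Adj c u).card ≤ k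

open Classical in
/-- The vertices with at most `k` out-neighbours in the core. -/
noncomputable def stuckSet (D : Digraph V) (S : Set V) (k : ℕ) : Finset V :=
  Finset.univ.filter fun u => ((coreSet D S k).filter fun c => D.Adj u c).card ≤ k

open Classical in
theorem sum_card_filter (R : V → V → Prop) (A : Finset V) :
    ∑ b ∈ A, (Finset.univ.filter (R b)).card =
      (Finset.univ.filter fun a : V × V => a.1 ∈ A ∧ R a.1 a.2).card := by
  simp only [Finset.card_filter]
  rw [← Finset.univ_product_univ, Finset.sum_product, ← Finset.sum_subset (Finset.subset_univ A)]
  · exact Finset.sum_congr rfl fun b hb => by simp [hb]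
  · intro b _ hb
    simp [hb]

open Classical in
theorem sum_card_filter' (R : V → V → Prop) (A : Finset V) :
    ∑ b ∈ A, (Finset.univ.filter fun u => R u b).card =
      (Finset.univ.filter fun a : V × V => a.2 ∈ A ∧ R a.1 a.2).card := by
  rw [sum_card_filter (fun b u => R u b) A]
  refine Finset.card_bij (fun a _ => a.swap) ?_ ?_ ?_
  · rintro a ha
    simpa using ha
  · rintro a _ b _ h
    exact Prod.swap_injective h
  · rintro ⟨a, b⟩ ha
    exact ⟨(b, a), by simpa using ha, rfl⟩

theorem sum_missDeg : ∑ u, missDeg D S u = 2 * missing D S := by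
  classical
  simp only [missDeg, Finset.sum_add_distrib]
  rw [sum_card_filter (Missing D S) Finset.univ, sum_card_filter' (Missing D S) Finset.univ]
  simp only [Finset.mem_univ, true_and, missing]
  omega

open Classical in
theorem card_compl_coreSet (k : ℕ) :
    (k + 1) * (Finset.univ \ coreSet D S k).card ≤ 2 * missing D S := by
  rw [← sum_missDeg, mul_comm, ← smul_eq_mul]
  refine (Finset.card_nsmul_le_sum _ (missDeg D S) (k + 1) fun u hu => ?_).trans
    (Finset.sum_le_sum_of_subset (Finset.subset_univ _))
  simp [coreSet] at hu
  omega

/-- The missing pairs with exactly one vertex in `C` are counted at most once. -/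
theorem sum_coreCost_le {C : Set V} {A : Finset V} (hA : ↑A ⊆ C) :
    ∑ b ∈ A, coreCost D S C b ≤ missing D S := by
  classical
  obtain ⟨R, hR⟩ : ∃ R : V → V → Prop, ∀ b u, R b u ↔
      u ∉ C ∧ (completeBipartite S).Adj b u ∧ ¬ D.Adj b u := ⟨_, fun _ _ => Iff.rfl⟩
  obtain ⟨R', hR'⟩ : ∃ R' : V → V → Prop, ∀ u b, R' u b ↔
      u ∉ C ∧ (completeBipartite S).Adj b u ∧ ¬ D.Adj u b := ⟨_, fun _ _ => Iff.rfl⟩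
  have e : ∑ b ∈ A, coreCost D S C b =
      (Finset.univ.filter fun a : V × V => a.1 ∈ A ∧ R a.1 a.2).card +
      (Finset.univ.filter fun a : V × V => a.2 ∈ A ∧ R' a.1 a.2).card := by
    rw [← sum_card_filter R A, ← sum_card_filter' R' A, ← Finset.sum_add_distrib]
    refine Finset.sum_congr rfl fun b _ => ?_
    simp only [coreCost, hR, hR']
  rw [e, ← Finset.card_union_of_disjoint]
  · refine Finset.card_le_card fun a ha => ?_
    rw [Finset.mem_union, Finset.mem_filter, Finset.mem_filter, hR, hR'] at ha
    rw [Finset.mem_filter]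
    refine ⟨Finset.mem_univ _, ?_⟩
    rcases ha with ha | ha
    · exact ha.2.2.2
    · exact ⟨completeBipartite_adj_comm.1 ha.2.2.2.1, ha.2.2.2.2⟩
  · rw [Finset.disjoint_left]
    intro a ha ha'
    rw [Finset.mem_filter, hR] at ha
    rw [Finset.mem_filter, hR'] at ha'
    exact ha'.2.2.1 (hA ha.2.1)

open Classical in
theorem missing_add_size (hS : D ≤ completeBipartite S) :
    missing D S + size D =
      2 * ((Finset.univ.filter (· ∈ S)).card * (Finset.univ.filter (· ∉ S)).card) := by
  have h1 : size D = (Finset.univ.filter fun a : V × V => D.Adj a.1 a.2).card := by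
    rw [size, Set.ncard_eq_toFinset_card']
    congr 1
    ext a
    rw [Set.mem_toFinset, Finset.mem_filter]
    exact ⟨fun h => ⟨Finset.mem_univ _, h⟩, fun h => h.2⟩
  rw [h1, missing, ← Finset.card_union_of_disjoint, two_mul]
  · nth_rw 2 [mul_comm]
    rw [← Finset.card_product, ← Finset.card_product, ← Finset.card_union_of_disjoint]
    · congr 1
      ext a
      have := @hS a.1 a.2
      simp only [completeBipartite] at this
      simp only [Finset.mem_union, Finset.mem_filter, Finset.mem_univ, true_and,
        Finset.mem_product]
      simp only [Missing, completeBipartite]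
      tauto
    · rw [Finset.disjoint_left]
      intro a ha ha'
      simp only [Finset.mem_filter, Finset.mem_univ, true_and, Finset.mem_product] at ha ha'
      exact ha'.1 ha.1
  · rw [Finset.disjoint_left]
    intro a ha ha'
    rw [Finset.mem_filter] at ha ha'
    exact ha.2.2 ha'.2

variable {k : ℕ}

open Classical in
theorem mem_coreSet {u : V} : u ∈ coreSet D S k ↔ missDeg D S u ≤ k := by simp [coreSet]

open Classical in
theorem card_missing_out {u : V} (hu : u ∈ coreSet D S k) :
    (Finset.univ.filter fun v => Missing D S u v).card ≤ k :=
  (Nat.le_add_right _ _).trans (mem_coreSet.1 hu)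

open Classical in
theorem card_missing_in {u : V} (hu : u ∈ coreSet D S k) :
    (Finset.univ.filter fun v => Missing D S v u).card ≤ k :=
  (Nat.le_add_left _ _).trans (mem_coreSet.1 hu)

open Classical in
/-- A set of more than `k` vertices in the other class contains an out-neighbour of each core
vertex. -/
theorem exists_adj_of_card {u : V} (hu : u ∈ coreSet D S k) {A : Finset V}
    (hA : ∀ c ∈ A, (completeBipartite S).Adj u c) (hc : k < A.card) : ∃ c ∈ A, D.Adj u c := by
  by_contra! h
  have : A ⊆ Finset.univ.filter fun v => Missing D S u v := fun c hcA => by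
    rw [Finset.mem_filter]
    exact ⟨Finset.mem_univ _, hA c hcA, h c hcA⟩
  have h1 := Finset.card_le_card this
  have h2 := card_missing_out hu
  omega

open Classical in
theorem exists_adj_of_card' {u : V} (hu : u ∈ coreSet D S k) {A : Finset V}
    (hA : ∀ c ∈ A, (completeBipartite S).Adj c u) (hc : k < A.card) : ∃ c ∈ A, D.Adj c u := by
  by_contra! h
  have : A ⊆ Finset.univ.filter fun v => Missing D S v u := fun c hcA => by
    rw [Finset.mem_filter]
    exact ⟨Finset.mem_univ _, hA c hcA, h c hcA⟩
  have h1 := Finset.card_le_card this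
  have h2 := card_missing_in hu
  omega

theorem ndist_le_two_of_not_far (hS : D ≤ completeBipartite S) {b u : V}
    (hb : b ∈ coreSet D S k) (hu : u ∉ farSet D S k) (hbu : b ∈ S ↔ u ∈ S) :
    ndist D b u ≤ 2 := by
  classical
  simp only [farSet, Finset.mem_filter, Finset.mem_univ, true_and, not_le] at hu
  obtain ⟨c, hc, hbc⟩ := exists_adj_of_card hb (A := (coreSet D S k).filter fun c => D.Adj c u)
    (fun c hc => by
      have := adj_mem_iff hS (Finset.mem_filter.1 hc).2
      rw [completeBipartite_adj_iff]
      tauto) hu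
  exact ndist_le_two hbc (Finset.mem_filter.1 hc).2

open Classical in
/-- The part of the core in the class opposite to `u`. -/
theorem card_core_opp {m : ℕ} (h1 : m ≤ ((coreSet D S k).filter (· ∈ S)).card)
    (h2 : m ≤ ((coreSet D S k).filter (· ∉ S)).card) (u : V) :
    m ≤ ((coreSet D S k).filter fun c => (completeBipartite S).Adj u c).card := by
  simp only [completeBipartite_adj_iff]
  by_cases hu : u ∈ S
  · simpa [hu] using h2
  · simpa [hu] using h1

open Classical in
theorem card_core_in {m : ℕ} (h1 : m ≤ ((coreSet D S k).filter (· ∈ S)).card)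
    (h2 : m ≤ ((coreSet D S k).filter (· ∉ S)).card) (u : V) :
    m ≤ ((coreSet D S k).filter fun c => D.Adj c u).card +
      (Finset.univ.filter fun c => Missing D S c u).card := by
  refine (card_core_opp h1 h2 u).trans
    ((Finset.card_le_card fun c hc => ?_).trans (Finset.card_union_le _ _))
  rw [Finset.mem_filter] at hc
  rw [Finset.mem_union, Finset.mem_filter, Finset.mem_filter]
  by_cases h : D.Adj c u
  · exact .inl ⟨hc.1, h⟩
  · exact .inr ⟨Finset.mem_univ _, completeBipartite_adj_comm.1 hc.2, h⟩

open Classical in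
theorem card_core_out {m : ℕ} (h1 : m ≤ ((coreSet D S k).filter (· ∈ S)).card)
    (h2 : m ≤ ((coreSet D S k).filter (· ∉ S)).card) (u : V) :
    m ≤ ((coreSet D S k).filter fun c => D.Adj u c).card +
      (Finset.univ.filter fun c => Missing D S u c).card := by
  refine (card_core_opp h1 h2 u).trans
    ((Finset.card_le_card fun c hc => ?_).trans (Finset.card_union_le _ _))
  rw [Finset.mem_filter] at hc
  rw [Finset.mem_union, Finset.mem_filter, Finset.mem_filter]
  by_cases h : D.Adj u c
  · exact .inl ⟨hc.1, h⟩
  · exact .inr ⟨Finset.mem_univ _, hc.2, h⟩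

open Classical in
/-- Each far vertex is missing almost all arcs from one class of the core, so there are few. -/
theorem card_farSet_mul_le {m : ℕ} (h1 : m + k ≤ ((coreSet D S k).filter (· ∈ S)).card)
    (h2 : m + k ≤ ((coreSet D S k).filter (· ∉ S)).card) :
    (farSet D S k).card * m ≤ missing D S := by
  calc (farSet D S k).card * m
      ≤ ∑ u ∈ farSet D S k, (Finset.univ.filter fun c => Missing D S c u).card := by
        rw [← smul_eq_mul]
        refine Finset.card_nsmul_le_sum _ _ _ fun u hu => ?_
        have := card_core_in h1 h2 u
        simp only [farSet, Finset.mem_filter, Finset.mem_univ, true_and] at hu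
        omega
    _ ≤ missing D S := by
        rw [sum_card_filter' (Missing D S)]
        refine Finset.card_le_card fun a ha => ?_
        rw [Finset.mem_filter] at ha ⊢
        exact ⟨ha.1, ha.2.2⟩

open Classical in
theorem card_stuckSet_mul_le {m : ℕ} (h1 : m + k ≤ ((coreSet D S k).filter (· ∈ S)).card)
    (h2 : m + k ≤ ((coreSet D S k).filter (· ∉ S)).card) :
    (stuckSet D S k).card * m ≤ missing D S := by
  calc (stuckSet D S k).card * m
      ≤ ∑ u ∈ stuckSet D S k, (Finset.univ.filter fun c => Missing D S u c).card := by
        rw [← smul_eq_mul]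
        refine Finset.card_nsmul_le_sum _ _ _ fun u hu => ?_
        have := card_core_out h1 h2 u
        simp only [stuckSet, Finset.mem_filter, Finset.mem_univ, true_and] at hu
        omega
    _ ≤ missing D S := by
        rw [sum_card_filter (Missing D S)]
        refine Finset.card_le_card fun a ha => ?_
        rw [Finset.mem_filter] at ha ⊢
        exact ⟨ha.1, ha.2.2⟩

open Classical in
theorem ndist_le_three (hS : D ≤ completeBipartite S) (hD : Biconnected D)
    (h1 : 2 * k + 1 ≤ ((coreSet D S k).filter (· ∈ S)).card)
    (h2 : 2 * k + 1 ≤ ((coreSet D S k).filter (· ∉ S)).card) {x y : V}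
    (hx : x ∉ stuckSet D S k) (hy : y ∈ coreSet D S k) : ndist D x y ≤ 3 := by
  simp only [stuckSet, Finset.mem_filter, Finset.mem_univ, true_and, not_le] at hx
  by_cases hxy : x ∈ S ↔ y ∈ S
  · obtain ⟨c, hc, hcy⟩ := exists_adj_of_card' hy
      (A := (coreSet D S k).filter fun c => D.Adj x c)
      (fun c hc => by
        have := adj_mem_iff hS (Finset.mem_filter.1 hc).2
        rw [completeBipartite_adj_iff]
        tauto) hx
    have := ndist_le_two (Finset.mem_filter.1 hc).2 hcy
    omega
  · obtain ⟨c, hc⟩ := Finset.card_pos.1 (lt_of_le_of_lt (Nat.zero_le _) hx)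
    rw [Finset.mem_filter] at hc
    have hyf : y ∉ farSet D S k := by
      simp only [farSet, Finset.mem_filter, Finset.mem_univ, true_and, not_le]
      have h3 := card_core_in h1 h2 y
      have h4 := card_missing_in hy
      omega
    have h5 := ndist_le_two_of_not_far hS hc.1 hyf (by
      have := adj_mem_iff hS hc.2
      tauto)
    have h6 := hD.ndist_le_one_add hc.2 y
    omega

open Classical in
/-- The core vertices that have no arc to a far vertex and none from a stuck vertex, and that are
joined to all core vertices of the other class with an arc to a far vertex. -/
noncomputable def typicalSet (D : Digraph V) (S : Set V) (k : ℕ) : Finset V :=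
  (coreSet D S k).filter fun b =>
    (∀ u ∈ farSet D S k, ¬ D.Adj b u) ∧ (∀ u ∈ stuckSet D S k, ¬ D.Adj u b) ∧
      ∀ c ∈ coreSet D S k, (∃ u ∈ farSet D S k, D.Adj c u) → ¬ Missing D S b c

open Classical in
/-- All but boundedly many core vertices are typical. -/
theorem card_core_sdiff_typical {f : ℕ} (hf : (farSet D S k).card ≤ f)
    (hs : (stuckSet D S k).card ≤ f) :
    (coreSet D S k \ typicalSet D S k).card ≤ 2 * (f * k) + f * k * k := by
  set X := (farSet D S k).biUnion fun u => (coreSet D S k).filter fun c => D.Adj c u with hX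
  set Y := (stuckSet D S k).biUnion fun u => (coreSet D S k).filter fun c => D.Adj u c with hY
  set Z := X.biUnion fun c => Finset.univ.filter fun b => Missing D S b c with hZ
  have cX : X.card ≤ f * k :=
    (Finset.card_biUnion_le_card_mul _ _ k fun u hu => (Finset.mem_filter.1 hu).2).trans
      (Nat.mul_le_mul_right _ hf)
  have cY : Y.card ≤ f * k :=
    (Finset.card_biUnion_le_card_mul _ _ k fun u hu => (Finset.mem_filter.1 hu).2).trans
      (Nat.mul_le_mul_right _ hs)
  have cZ : Z.card ≤ f * k * k := by
    refine (Finset.card_biUnion_le_card_mul _ _ k fun c hc => ?_).trans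
      (Nat.mul_le_mul_right _ cX)
    obtain ⟨u, -, hcu⟩ := Finset.mem_biUnion.1 hc
    exact card_missing_in (Finset.mem_filter.1 hcu).1
  have hsub : coreSet D S k \ typicalSet D S k ⊆ X ∪ Y ∪ Z := by
    intro b hb
    rw [Finset.mem_sdiff, typicalSet, Finset.mem_filter] at hb
    obtain ⟨hbC, hbT⟩ := hb
    by_contra hn
    simp only [Finset.mem_union, not_or] at hn
    refine hbT ⟨hbC, fun u hu hbu => hn.1.1 ?_, fun u hu hub => hn.1.2 ?_,
      fun c hc ⟨u, hu, hcu⟩ hm => hn.2 ?_⟩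
    · exact Finset.mem_biUnion.2 ⟨u, hu, Finset.mem_filter.2 ⟨hbC, hbu⟩⟩
    · exact Finset.mem_biUnion.2 ⟨u, hu, Finset.mem_filter.2 ⟨hbC, hub⟩⟩
    · exact Finset.mem_biUnion.2 ⟨c, Finset.mem_biUnion.2 ⟨u, hu, Finset.mem_filter.2 ⟨hc, hcu⟩⟩,
        Finset.mem_filter.2 ⟨Finset.mem_univ _, hm⟩⟩
  have h1 := Finset.card_le_card hsub
  have h2 := Finset.card_union_le (X ∪ Y) Z
  have h3 := Finset.card_union_le X Y
  omega

open Classical in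
theorem corePair_of_typical (hS : D ≤ completeBipartite S) (hD : Biconnected D)
    (h1 : 2 * k + 1 ≤ ((coreSet D S k).filter (· ∈ S)).card)
    (h2 : 2 * k + 1 ≤ ((coreSet D S k).filter (· ∉ S)).card) {p q : V}
    (hp : p ∈ typicalSet D S k) (hq : q ∈ typicalSet D S k) (hpS : p ∈ S) (hqS : q ∉ S)
    (hpq : D.Adj p q) (hqp : D.Adj q p) :
    CorePair D S (coreSet D S k) (· ∈ farSet D S k) p q := by
  have hT : ∀ a, a = p ∨ a = q → a ∈ typicalSet D S k := by
    rintro a (rfl | rfl) <;> assumption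
  have hcs : ∀ x ∈ coreSet D S k, x ∉ stuckSet D S k := by
    intro x hx
    simp only [stuckSet, Finset.mem_filter, Finset.mem_univ, true_and, not_le]
    have h3 := card_core_out h1 h2 x
    have h4 := card_missing_out hx
    omega
  refine ⟨⟨hS, hD, hpS, hqS, hpq, hqp⟩, (Finset.mem_filter.1 hp).1, (Finset.mem_filter.1 hq).1,
    fun b hb u hu hbu => ndist_le_two_of_not_far hS hb hu hbu, fun a ha g hag hg => ?_,
    fun a ha c hc hac => ?_, fun a ha x hxa y hy => ?_,
    fun x hx y hy => ndist_le_three hS hD h1 h2 (hcs x hx) hy⟩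
  · exact (Finset.mem_filter.1 (hT a ha)).2.1 g hg hag
  · by_cases hex : ∃ u ∈ farSet D S k, D.Adj c u
    · left
      by_contra hn
      exact (Finset.mem_filter.1 (hT a ha)).2.2.2 c hc hex ⟨hac, hn⟩
    · right
      exact fun s hs hf => hex ⟨s, hf, hs⟩
  · exact ndist_le_three hS hD h1 h2
      (fun hx => (Finset.mem_filter.1 (hT a ha)).2.2.1 x hx hxa) hy

open Classical in
/-- Averaging over the typical vertices yields a bidirected edge between typical vertices of small
total cost. -/
theorem exists_cheap_pair {r l : ℕ} (hl : 0 < l)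
    (h1 : l + k ≤ ((typicalSet D S k).filter (· ∈ S)).card)
    (h2 : l + k ≤ ((typicalSet D S k).filter (· ∉ S)).card)
    (hm : missing D S < l * (2 * r - 3)) :
    ∃ p ∈ typicalSet D S k, ∃ q ∈ typicalSet D S k, p ∈ S ∧ q ∉ S ∧ D.Adj p q ∧ D.Adj q p ∧
      coreCost D S (coreSet D S k) p + coreCost D S (coreSet D S k) q + 4 ≤ 2 * r := by
  set cost := coreCost D S (coreSet D S k)
  set A := (typicalSet D S k).filter (· ∈ S) with hA
  -- Take `p` of minimal cost in its class, and `q` among the vertices joined to `p`.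
  obtain ⟨p, hp, hmin⟩ := Finset.exists_min_image A cost (Finset.card_pos.1 (by omega))
  set B := (typicalSet D S k).filter (fun b => b ∉ S ∧ D.Adj p b ∧ D.Adj b p) with hB
  have hpT := (Finset.mem_filter.1 hp).1
  have hpS := (Finset.mem_filter.1 hp).2
  have hpC := (Finset.mem_filter.1 hpT).1
  have hBcard : l ≤ B.card := by
    have hsub : (typicalSet D S k).filter (· ∉ S) ⊆
        B ∪ ((Finset.univ.filter fun b => Missing D S p b) ∪
          (Finset.univ.filter fun b => Missing D S b p)) := by
      intro b hb
      rw [Finset.mem_filter] at hb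
      simp only [Finset.mem_union, Finset.mem_filter, Finset.mem_univ, true_and, hB, Missing,
        completeBipartite_adj_iff]
      tauto
    have h3 := Finset.card_le_card hsub
    have h4 := Finset.card_union_le B ((Finset.univ.filter fun b => Missing D S p b) ∪
          (Finset.univ.filter fun b => Missing D S b p))
    have h5 := Finset.card_union_le (Finset.univ.filter fun b => Missing D S p b)
          (Finset.univ.filter fun b => Missing D S b p)
    have h6 : (Finset.univ.filter fun b => Missing D S p b).card +
      (Finset.univ.filter fun b => Missing D S b p).card ≤ k := mem_coreSet.1 hpC
    omega
  by_contra! hno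
  have hcost : ∀ b ∈ B, 2 * r - 3 - cost p ≤ cost b := by
    intro b hb
    obtain ⟨hbT, hbS, hpb, hbp⟩ := Finset.mem_filter.1 hb
    have := hno p hpT b hbT hpS hbS hpb hbp
    omega
  have hdisj : Disjoint A B := by
    rw [Finset.disjoint_left]
    intro b hbA hbB
    exact (Finset.mem_filter.1 hbB).2.1 (Finset.mem_filter.1 hbA).2
  have hsub : (↑(A ∪ B) : Set V) ⊆ ↑(coreSet D S k) := by
    intro b hb
    rw [Finset.mem_coe, Finset.mem_union] at hb
    rcases hb with hb | hb <;>
      exact (Finset.mem_filter.1 (Finset.mem_filter.1 hb).1).1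
  have e1 := sum_coreCost_le (D := D) (S := S) hsub
  rw [Finset.sum_union hdisj] at e1
  change A.sum cost + B.sum cost ≤ missing D S at e1
  have e2 := Finset.card_nsmul_le_sum A cost _ hmin
  have e3 := Finset.card_nsmul_le_sum B cost _ hcost
  rw [smul_eq_mul] at e2 e3
  have e4 : l * cost p ≤ A.card * cost p := Nat.mul_le_mul_right _ (by omega)
  have e5 : l * (2 * r - 3 - cost p) ≤ B.card * (2 * r - 3 - cost p) :=
    Nat.mul_le_mul_right _ hBcard
  have e6 : l * (2 * r - 3) ≤ l * cost p + l * (2 * r - 3 - cost p) := by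
    rw [← Nat.mul_add]
    exact Nat.mul_le_mul_left _ (by omega)
  omega

end missing

end DirectedGraph

namespace DirectedGraph

/-! ### Digraphs of large order -/

/-- Nearly as many arcs as in a balanced complete bipartite digraph force nearly equal classes. -/
theorem balanced_of_sq_le {n a b r s : ℕ} (hab : a + b = n) (hs : s ≤ 2 * (a * b))
    (h : n ^ 2 + 4 * n ≤ 2 * s + 2 * r * n + 8 * r + 1) (hn : 3200 * r ^ 3 < n)
    (hrn : 8 * r + 1 ≤ n) :
    40 * r * n ≤ 80 * r * a + n := by
  by_contra! hlt
  obtain ⟨d, rfl⟩ : ∃ d, b = a + d := by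
    refine ⟨b - a, ?_⟩
    have : a ≤ b := by
      by_contra! hba
      have : n ≤ 2 * a := by omega
      nlinarith
    omega
  have h1 : n < 40 * r * d := by
    subst hab
    nlinarith
  have h2 : d ^ 2 ≤ 2 * r * n := by
    subst hab
    nlinarith
  have h3 : n * n ≤ (3200 * r ^ 3) * n := by
    calc n * n ≤ (40 * r * d) * (40 * r * d) := Nat.mul_le_mul h1.le h1.le
      _ = 1600 * r ^ 2 * d ^ 2 := by ring
      _ ≤ 1600 * r ^ 2 * (2 * r * n) := Nat.mul_le_mul_left _ h2
      _ = (3200 * r ^ 3) * n := by ring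
  have := Nat.le_of_mul_le_mul_right h3 (by omega)
  omega

/-- The numerical estimates behind the choice of a core pair. Here `a` and `b` are the sizes of the
classes, `s` the number of arcs, `m` the number of missing arcs, and `c` the number of vertices
outside the core. -/
theorem exists_bound {n a b r s m c : ℕ} (hr : 4 ≤ r) (hab : a + b = n)
    (hm : m + s = 2 * (a * b)) (h : n ^ 2 + 4 * n ≤ 2 * s + 2 * r * n + 8 * r + 1)
    (hc : (80 * r ^ 2 + 1) * c ≤ 2 * m) (hn : 2000000 * r ^ 6 ≤ n) :
    ∃ l, 80 * r ^ 2 < l ∧ m < l * (2 * r - 3) ∧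
      c + (2 * (2 * r * (80 * r ^ 2)) + 2 * r * (80 * r ^ 2) * (80 * r ^ 2)) + 80 * r ^ 2 + l ≤ a ∧
      c + (2 * (2 * r * (80 * r ^ 2)) + 2 * r * (80 * r ^ 2) * (80 * r ^ 2)) + 80 * r ^ 2 + l ≤
        b := by
  have p2 : r ^ 2 ≤ r ^ 6 := Nat.pow_le_pow_right (by omega) (by omega)
  have p3 : r ^ 3 ≤ r ^ 6 := Nat.pow_le_pow_right (by omega) (by omega)
  have p4 : r ^ 4 ≤ r ^ 6 := Nat.pow_le_pow_right (by omega) (by omega)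
  have p1 : r ^ 1 ≤ r ^ 6 := Nat.pow_le_pow_right (by omega) (by omega)
  rw [pow_one] at p1
  have pos : 0 < r ^ 6 := by positivity
  set N := r ^ 6
  have h2m : 2 * m + 4 * n ≤ 2 * r * n + 8 * r + 1 := by
    have : 4 * (a * b) ≤ n ^ 2 := by
      rw [← hab]
      nlinarith [sq_nonneg ((a : ℤ) - b), four_mul_le_sq_add a b]
    omega
  have ha := balanced_of_sq_le (r := r) (s := s) hab (by omega) h (by omega) (by omega)
  have hb := balanced_of_sq_le (r := r) (s := s) (a := b) (b := a) (by omega)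
    (by rw [mul_comm b a]; omega) h (by omega) (by omega)
  set e := (2 * (2 * r * (80 * r ^ 2)) + 2 * r * (80 * r ^ 2) * (80 * r ^ 2)) + 80 * r ^ 2 with he
  have hce : 80 * r * c ≤ 2 * n := by
    have h1 : (40 * r * c) * (2 * r) ≤ n * (2 * r) := by
      calc (40 * r * c) * (2 * r) = 80 * r ^ 2 * c := by ring
        _ ≤ (80 * r ^ 2 + 1) * c := Nat.mul_le_mul_right _ (by omega)
        _ ≤ n * (2 * r) := by rw [mul_comm n]; omega
    have := Nat.le_of_mul_le_mul_right h1 (by omega)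
    linarith
  have hee : 80 * r * e ≤ n := by
    calc 80 * r * e = 25600 * r ^ 4 + 1024000 * N + 6400 * r ^ 3 := by rw [he]; ring
      _ ≤ n := by omega
  -- Both classes have size about `n / 2`, of which `c + e` is only a small part.
  have hmin : 40 * r * n ≤ 80 * r * min a b + n := by
    rcases min_choice a b with h | h <;> rw [h] <;> assumption
  have hrn : 4 * n ≤ r * n := Nat.mul_le_mul_right _ hr
  obtain ⟨l, hl⟩ : ∃ l, min a b = c + e + l := by
    refine Nat.exists_eq_add_of_le (le_of_mul_le_mul_left (a := 80 * r) ?_ (by omega))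
    rw [mul_add]
    linarith
  have hl2 : 40 * r * n ≤ 80 * r * l + 4 * n := by
    rw [hl, mul_add, mul_add] at hmin
    omega
  have hl4 : n ≤ 4 * l := by
    have : (20 * r) * n ≤ (20 * r) * (4 * l) := by linarith
    exact Nat.le_of_mul_le_mul_left this (by omega)
  refine ⟨l, by omega, ?_, by omega, by omega⟩
  obtain ⟨t, ht⟩ : ∃ t, 2 * r - 3 = t ∧ 2 * r = t + 3 := ⟨2 * r - 3, rfl, by omega⟩
  rw [ht.1]
  have h80 : 80 * r * m < 80 * r * (l * t) := by
    have h1 : 40 * r * n * t ≤ (80 * r * l + 4 * n) * t := Nat.mul_le_mul_right _ hl2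
    have h2 : 40 * r * (2 * m + 4 * n) ≤ 40 * r * (2 * r * n + 8 * r + 1) :=
      Nat.mul_le_mul_left _ h2m
    have h3 : 40 * r * (2 * r * n) = 40 * r * n * t + 120 * (r * n) := by
      rw [ht.2]; ring
    have h4 : 4 * n * t + 12 * n = 8 * (r * n) := by
      have : 4 * n * (t + 3) = 4 * n * (2 * r) := by rw [ht.2]
      linarith
    have h5 : r * (40 * (8 * r + 1)) ≤ r * n := Nat.mul_le_mul_left _ (by omega)
    have h6 : 0 < r * n := Nat.mul_pos (by omega) (by omega)
    linarith
  exact Nat.lt_of_mul_lt_mul_left h80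

/-- For large order, a digraph with at least as many arcs as the extremal one is isomorphic to
it. -/
theorem isomorphic_extremal_of_le {V : Type*} [Fintype V] {D : Digraph V} {S : Set V} {r : ℕ}
    (hr : 4 ≤ r) (hre : Even r) (hS : D ≤ completeBipartite S) (hD : Biconnected D)
    (hecc : ∀ x, ∃ y, r ≤ ndist D x y) (hn : 2000000 * r ^ 6 ≤ Fintype.card V)
    (hsize : size (extremal (Fintype.card V) r) ≤ size D) :
    Isomorphic D (extremal (Fintype.card V) r) := by
  classical
  have hrn : r ≤ r ^ 6 := Nat.le_self_pow (by omega) r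
  have hab : (Finset.univ.filter (· ∈ S)).card + (Finset.univ.filter (· ∉ S)).card =
      Fintype.card V := by
    rw [Finset.card_filter_add_card_filter_not, Finset.card_univ]
  have hsq := sq_le_size_extremal (n := Fintype.card V) (r := r) (by omega) (by omega)
  obtain ⟨l, hkl, hml, h1, h2⟩ := exists_bound hr hab (missing_add_size hS) (by omega)
    (card_compl_coreSet (D := D) (S := S) (80 * r ^ 2)) hn
  set k := 80 * r ^ 2
  have split : ∀ (A B : Finset V) (T : Set V), (A.filter (· ∈ T)).card ≤
      (B.filter (· ∈ T)).card + (A \ B).card := by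
    intro A B T
    refine (Finset.card_le_card fun u hu => ?_).trans (Finset.card_union_le _ _)
    simp only [Finset.mem_union, Finset.mem_filter, Finset.mem_sdiff] at hu ⊢
    tauto
  have c1 := split Finset.univ (coreSet D S k) S
  have c2 := split Finset.univ (coreSet D S k) Sᶜ
  have c3 := split (coreSet D S k) (typicalSet D S k) S
  have c4 := split (coreSet D S k) (typicalSet D S k) Sᶜ
  simp only [Set.mem_compl_iff] at c2 c4
  have small : ∀ x, x * l ≤ missing D S → x ≤ 2 * r := by
    intro x hx
    have : x * l < (2 * r - 3) * l := by rw [mul_comm (2 * r - 3)]; omega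
    have := Nat.lt_of_mul_lt_mul_right this
    omega
  have c5 := card_core_sdiff_typical
    (small _ (card_farSet_mul_le (D := D) (S := S) (k := k) (m := l) (by omega) (by omega)))
    (small _ (card_stuckSet_mul_le (D := D) (S := S) (k := k) (m := l) (by omega) (by omega)))
  obtain ⟨p, hp, q, hq, hpS, hqS, hpq, hqp, hcost⟩ :=
    exists_cheap_pair (D := D) (S := S) (k := k) (r := r) (l := l) (by omega) (by omega)
      (by omega) hml
  exact (corePair_of_typical hS hD (by omega) (by omega) hp hq hpS hqS hpq
    hqp).isomorphic_extremal hr hre hecc hcost hsize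

theorem Isomorphic.size_eq {V W : Type*} {D : Digraph V} {E : Digraph W} (h : Isomorphic D E) :
    size D = size E := by
  obtain ⟨e⟩ := h
  refine Set.ncard_congr (fun a _ => (e a.1, e a.2)) ?_ ?_ ?_
  · intro a ha
    exact e.map_rel_iff.2 ha
  · intro a b _ _ hab
    exact Prod.ext (e.injective (Prod.ext_iff.1 hab).1) (e.injective (Prod.ext_iff.1 hab).2)
  · intro b hb
    refine ⟨(e.symm b.1, e.symm b.2), e.symm.map_rel_iff.2 hb, ?_⟩
    simp

end DirectedGraph

theorem mainTheorem3 (r : ℕ) (hr : 4 ≤ r) (hr_even : Even r) :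
    ∃ n₁ : ℕ, ∀ n : ℕ, n₁ ≤ n →
      (Fintype.card (DirectedGraph.DVertex n r (DirectedGraph.balancedParam n r)) = n ∧
        DirectedGraph.Bipartite (DirectedGraph.extremal n r) ∧
        DirectedGraph.Biconnected (DirectedGraph.extremal n r) ∧
        DirectedGraph.outRadius (DirectedGraph.extremal n r) = (r : ℕ∞)) ∧
      ∀ (V : Type*) [Fintype V] (D : Digraph V),
        Fintype.card V = n → DirectedGraph.Bipartite D → DirectedGraph.Biconnected D →
        DirectedGraph.outRadius D = (r : ℕ∞) →
          DirectedGraph.size D ≤ DirectedGraph.size (DirectedGraph.extremal n r) ∧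
          (DirectedGraph.size D = DirectedGraph.size (DirectedGraph.extremal n r) →
            DirectedGraph.Isomorphic D (DirectedGraph.extremal n r)) := by
  refine ⟨2000000 * r ^ 6, fun n hn => ⟨?_, ?_⟩⟩
  · have hrn : r ≤ r ^ 6 := Nat.le_self_pow (by omega) r
    have hsurj := DirectedGraph.surjective_extremal (n := n) (r := r) (by omega) (by omega)
    refine ⟨DirectedGraph.card_DVertex (by omega) hr_even (by omega), ?_⟩
    rw [DirectedGraph.extremal_eq_pullback]
    exact ⟨DirectedGraph.bipartite_pullback,
      DirectedGraph.biconnected_pullback hsurj (by omega),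
      DirectedGraph.outRadius_pullback hsurj (by omega)⟩
  · rintro V _ D rfl ⟨S, hS⟩ hD hrad
    have key := DirectedGraph.isomorphic_extremal_of_le hr hr_even hS hD
      (DirectedGraph.exists_le_ndist hD (by omega) hrad.ge) hn
    refine ⟨?_, fun heq => key heq.ge⟩
    by_contra! hlt
    exact hlt.ne (key hlt.le).size_eq.symm
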